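/- Let $q$ be a power of a prime number. A *Weil $q$-number* is an algebraic integer $\pi$ in a field of characteristic zero such that $|\iota(\pi)| = q^{1/2}$ for every embedding $\iota : \mathbb{Q}(\pi) \hookrightarrow \mathbb{C}$; two Weil $q$-numbers $\pi, \pi'$ are *conjugate* if there is an isomorphism $\mathbb{Q}(\pi) \simeq \mathbb{Q}(\pi')$ carrying $\pi$ to $\pi'$. Let $W_q$ be the set of conjugacy classes of Weil $q$-numbers. For a finite subset $w \subseteq W_q$ with representatives $\pi_1, \dots, \pi_r$, the *minimal central order* $R_w$ is the quotient of $\mathbb{Z}[F,V]/(FV-q)$ by the kernel of the ring homomorphism to $\prod_{i=1}^{r} \mathbb{Q}(\pi_i)$ that sends $F$ to $(\pi_1,\dots,\pi_r)$ and $V$ to $(q/\pi_1,\dots,q/\pi_r)$ (it does not depend on the representatives). For finite $v \subseteq w$ there is a natural surjection $R_w \to R_v$. For a subset $W \subseteq W_q$ let $\mathcal{R}_W = (R_w)$ be the projective system with $w$ ranging over all finite subsets of $W$. An *$\mathcal{R}_W$-module* is a projective system $\mathcal{M} = (M_w)$, indexed by the finite subsets $w \subseteq W$, of $R_w$-modules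 $M_w$ whose transition maps $M_w \to M_v$ ($v \subseteq w$) are $R_w$-linear; a homomorphism of $\mathcal{R}_W$-modules is a family of $R_w$-linear maps compatible with the transition maps. $\mathcal{M}$ is *invertible* if every $M_w$ is an invertible $R_w$-module and all transition maps $M_w \to M_v$ are surjective. The isomorphism classes of invertible $\mathcal{R}_W$-modules form a group $\operatorname{Pic}(\mathcal{R}_W)$ under the levelwise tensor product. Let $V \subseteq W \subseteq W_q$ be subsets. Then the natural restriction homomorphism $$\operatorname{Pic}(\mathcal{R}_W) \longrightarrow \operatorname{Pic}(\mathcal{R}_V), \qquad (M_w)_{w \subseteq W} \longmapsto (M_w)_{w \subseteq V},$$ is surjective. -/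

import Mathlib

open scoped IntermediateField TensorProduct

noncomputable section

/-! ### Weil numbers -/

/-- An element `π` of a field of characteristic zero is a Weil `q`-number if it is an algebraic
integer all of whose images under field embeddings `ℚ(π) → ℂ` have absolute value `q ^ (1/2)`. -/
def IsWeilNumber (q : ℕ) {K : Type*} [Field K] [CharZero K] (π : K) : Prop :=
  IsIntegral ℤ π ∧
    ∀ ι : ℚ⟮π⟯ →+* ℂ, ‖ι (IntermediateField.AdjoinSimple.gen ℚ π)‖ = Real.sqrt (q : ℝ)

/-- `π` and `π'` are conjugate if there is an isomorphism `ℚ(π) ≃ ℚ(π')` carrying `π` to `π'`. -/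
def WeilConjugate {K K' : Type*} [Field K] [CharZero K] [Field K'] [CharZero K']
    (π : K) (π' : K') : Prop :=
  ∃ e : ℚ⟮π⟯ ≃+* ℚ⟮π'⟯,
    e (IntermediateField.AdjoinSimple.gen ℚ π) = IntermediateField.AdjoinSimple.gen ℚ π'

/-- The Weil `q`-numbers in `ℂ`. Every Weil `q`-number in a field of characteristic zero is
conjugate to one of these, see `exists_weilConjugate` below. -/
def WeilNumber (q : ℕ) : Type := {π : ℂ // IsWeilNumber q π}

/-- Conjugacy as an equivalence relation on the Weil `q`-numbers. -/
instance WeilNumber.setoid (q : ℕ) : Setoid (WeilNumber q) where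
  r a b := WeilConjugate a.1 b.1
  iseqv :=
    { refl := fun _ => ⟨RingEquiv.refl _, rfl⟩
      symm := by
        rintro a b ⟨e, he⟩
        exact ⟨e.symm, by rw [← he, RingEquiv.symm_apply_apply]⟩
      trans := by
        rintro a b c ⟨e, he⟩ ⟨f, hf⟩
        exact ⟨e.trans f, by rw [RingEquiv.trans_apply, he, hf]⟩ }

/-- The set `W_q` of conjugacy classes of Weil `q`-numbers. -/
def WeilClass (q : ℕ) : Type := Quotient (WeilNumber.setoid q)

/-- The conjugacy class of a Weil `q`-number. -/
def WeilClass.mk {q : ℕ} (a : WeilNumber q) : WeilClass q := Quotient.mk _ a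

/-- A Weil `q`-number representing a given conjugacy class. -/
def WeilClass.rep {q : ℕ} (c : WeilClass q) : WeilNumber q := Quotient.out c

theorem WeilClass.mk_rep {q : ℕ} (c : WeilClass q) : WeilClass.mk c.rep = c := Quotient.out_eq c

theorem WeilConjugate.isWeilNumber {q : ℕ} {K K' : Type*} [Field K] [CharZero K] [Field K']
    [CharZero K'] {π : K} {π' : K'} (h : WeilConjugate π π') (hπ : IsWeilNumber q π) :
    IsWeilNumber q π' := by
  obtain ⟨e, he⟩ := h
  refine ⟨?_, fun ι => ?_⟩
  · have h1 : IsIntegral ℤ (IntermediateField.AdjoinSimple.gen ℚ π) := by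
      have h0 := hπ.1
      rw [← IntermediateField.AdjoinSimple.algebraMap_gen ℚ π] at h0
      exact (isIntegral_algebraMap_iff (algebraMap ℚ⟮π⟯ K).injective).1 h0
    have h2 := h1.map (e.toRingHom.toIntAlgHom)
    have h3 : e.toRingHom.toIntAlgHom (IntermediateField.AdjoinSimple.gen ℚ π)
        = IntermediateField.AdjoinSimple.gen ℚ π' := he
    rw [h3] at h2
    have h4 := h2.algebraMap (B := K')
    rwa [IntermediateField.AdjoinSimple.algebraMap_gen] at h4
  · have h1 := hπ.2 (ι.comp e.toRingHom)
    rw [← h1, ← he]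
    rfl

/-- Every Weil `q`-number in any field of characteristic zero is conjugate to one in `ℂ`. -/
theorem exists_weilConjugate (q : ℕ) {K : Type*} [Field K] [CharZero K] (π : K)
    (hπ : IsWeilNumber q π) : ∃ a : WeilNumber q, WeilConjugate π a.1 := by
  have hint : IsIntegral ℚ π := hπ.1.tower_top
  have : FiniteDimensional ℚ ℚ⟮π⟯ := IntermediateField.adjoin.finiteDimensional hint
  let ι : ℚ⟮π⟯ →ₐ[ℚ] ℂ := IsAlgClosed.lift
  have hmin : minpoly ℚ π = minpoly ℚ (ι (IntermediateField.AdjoinSimple.gen ℚ π)) := by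
    rw [minpoly.algHom_eq ι ι.injective]
    exact (IntermediateField.minpoly_gen ℚ π).symm
  have hint' : IsIntegral ℚ (ι (IntermediateField.AdjoinSimple.gen ℚ π)) :=
    (Algebra.IsIntegral.isIntegral (IntermediateField.AdjoinSimple.gen ℚ π)).map ι
  have hconj : WeilConjugate π (ι (IntermediateField.AdjoinSimple.gen ℚ π)) := by
    refine ⟨(((IntermediateField.adjoinRootEquivAdjoin ℚ hint).symm.trans
      (AdjoinRoot.algEquivOfEq ℚ _ _ hmin)).trans
      (IntermediateField.adjoinRootEquivAdjoin ℚ hint')).toRingEquiv, ?_⟩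
    change IntermediateField.adjoinRootEquivAdjoin ℚ hint' (AdjoinRoot.algEquivOfEq ℚ _ _ hmin
      ((IntermediateField.adjoinRootEquivAdjoin ℚ hint).symm _)) = _
    rw [IntermediateField.adjoinRootEquivAdjoin_symm_apply_gen, AdjoinRoot.algEquivOfEq_root,
      IntermediateField.adjoinRootEquivAdjoin_apply_root]
  exact ⟨⟨_, hconj.isWeilNumber hπ⟩, hconj⟩

/-- The field `ℚ(π)` of a Weil `q`-number `π`. -/
abbrev WeilNumber.field {q : ℕ} (a : WeilNumber q) : IntermediateField ℚ ℂ := ℚ⟮a.1⟯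

/-- The Weil `q`-number `π` as an element of `ℚ(π)`. -/
def WeilNumber.gen {q : ℕ} (a : WeilNumber q) : a.field :=
  IntermediateField.AdjoinSimple.gen ℚ a.1

theorem WeilNumber.gen_mul_div {q : ℕ} (a : WeilNumber q) :
    a.gen * ((q : a.field) / a.gen) = (q : a.field) := by
  by_cases h : a.gen = 0
  · have h1 := a.2.2 (algebraMap a.field ℂ)
    have h2 : IntermediateField.AdjoinSimple.gen ℚ a.1 = 0 := h
    rw [h2, map_zero, norm_zero] at h1
    have h3 : (q : ℝ) = 0 := (Real.sqrt_eq_zero (Nat.cast_nonneg q)).1 h1.symm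
    have h4 : q = 0 := by exact_mod_cast h3
    subst h4
    simp
  · exact mul_div_cancel₀ _ h

/-! ### Minimal central orders -/

/-- The ring `ℤ[F, V] / (F V - q)`; the variable `F` has index `0`, the variable `V` index `1`. -/
abbrev FrobVer (q : ℕ) : Type :=
  MvPolynomial (Fin 2) ℤ ⧸
    (Ideal.span {MvPolynomial.X 0 * MvPolynomial.X 1 - (q : MvPolynomial (Fin 2) ℤ)})

/-- The ring homomorphism `ℤ[F, V] / (F V - q) → ℚ(π)`, `F ↦ π`, `V ↦ q / π`. -/
def FrobVer.eval {q : ℕ} (a : WeilNumber q) : FrobVer q →+* a.field :=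
  Ideal.Quotient.lift _
    (MvPolynomial.eval₂Hom (Int.castRingHom a.field) ![a.gen, (q : a.field) / a.gen])
    (by
      intro x hx
      rw [← RingHom.mem_ker]
      refine (Ideal.span_le (I := RingHom.ker (MvPolynomial.eval₂Hom (Int.castRingHom a.field)
        ![a.gen, (q : a.field) / a.gen]))).2 ?_ hx
      rw [Set.singleton_subset_iff, SetLike.mem_coe, RingHom.mem_ker, map_sub, map_mul,
        map_natCast, sub_eq_zero]
      simpa using a.gen_mul_div)

@[simp]
theorem FrobVer.eval_frob {q : ℕ} (a : WeilNumber q) :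
    FrobVer.eval a (Ideal.Quotient.mk _ (MvPolynomial.X 0)) = a.gen := by
  simp [FrobVer.eval, -Fin.isValue]

@[simp]
theorem FrobVer.eval_ver {q : ℕ} (a : WeilNumber q) :
    FrobVer.eval a (Ideal.Quotient.mk _ (MvPolynomial.X 1)) = (q : a.field) / a.gen := by
  simp [FrobVer.eval, -Fin.isValue]

/-- The kernel of `F ↦ π`, `V ↦ q / π` depends only on the conjugacy class of `π`. -/
theorem FrobVer.ker_eval_eq {q : ℕ} {a b : WeilNumber q} (h : a ≈ b) :
    RingHom.ker (FrobVer.eval a) = RingHom.ker (FrobVer.eval b) := by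
  obtain ⟨e, he⟩ := h
  have he' : e a.gen = b.gen := he
  have key : e.toRingHom.comp (FrobVer.eval a) = FrobVer.eval b := by
    apply Ideal.Quotient.ringHom_ext
    apply MvPolynomial.ringHom_ext
    · intro n
      simp
    · intro i
      fin_cases i
      · change e (FrobVer.eval a (Ideal.Quotient.mk _ (MvPolynomial.X 0))) =
          FrobVer.eval b (Ideal.Quotient.mk _ (MvPolynomial.X 0))
        rw [FrobVer.eval_frob, FrobVer.eval_frob, he']
      · change e (FrobVer.eval a (Ideal.Quotient.mk _ (MvPolynomial.X 1))) =
          FrobVer.eval b (Ideal.Quotient.mk _ (MvPolynomial.X 1))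
        rw [FrobVer.eval_ver, FrobVer.eval_ver, map_div₀, map_natCast, he']
  ext x
  rw [RingHom.mem_ker, RingHom.mem_ker, ← key]
  exact (map_eq_zero_iff e e.injective).symm

/-- The ring homomorphism `ℤ[F, V] / (F V - q) → ∏ ℚ(π_i)`, `F ↦ (π_i)`, `V ↦ (q / π_i)`, where
the `π_i` represent the conjugacy classes in the finite set `w`. -/
def FrobVer.toProd {q : ℕ} (w : Finset (WeilClass q)) :
    FrobVer q →+* ((c : w) → c.1.rep.field) :=
  RingHom.pi fun c => FrobVer.eval c.1.rep

theorem FrobVer.mem_ker_toProd {q : ℕ} {w : Finset (WeilClass q)} {x : FrobVer q} :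
    x ∈ RingHom.ker (FrobVer.toProd w) ↔
      ∀ c ∈ w, FrobVer.eval c.rep x = 0 := by
  rw [RingHom.mem_ker, funext_iff]
  exact ⟨fun h c hc => h ⟨c, hc⟩, fun h c => h c.1 c.2⟩

/-- The kernel does not depend on the chosen representatives. -/
theorem FrobVer.ker_toProd_eq {q : ℕ} (w : Finset (WeilClass q)) (rep : w → WeilNumber q)
    (hrep : ∀ c : w, WeilClass.mk (rep c) = c.1) :
    RingHom.ker (FrobVer.toProd w) =
      RingHom.ker (RingHom.pi fun c : w => FrobVer.eval (rep c)) := by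
  ext x
  rw [RingHom.mem_ker, RingHom.mem_ker, funext_iff, funext_iff]
  refine forall_congr' fun c => ?_
  have h : c.1.rep ≈ rep c := Quotient.exact ((WeilClass.mk_rep c.1).trans (hrep c).symm)
  have h2 := FrobVer.ker_eval_eq h
  exact (SetLike.ext_iff.1 h2 x)

/-- The minimal central order `R_w` of a finite set `w` of conjugacy classes of Weil
`q`-numbers. -/
def MinCentralOrder {q : ℕ} (w : Finset (WeilClass q)) : Type :=
  FrobVer q ⧸ RingHom.ker (FrobVer.toProd w)

instance {q : ℕ} (w : Finset (WeilClass q)) : CommRing (MinCentralOrder w) :=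
  inferInstanceAs (CommRing (FrobVer q ⧸ RingHom.ker (FrobVer.toProd w)))

/-- The projection `R_w → R_v` for `v ⊆ w`. -/
def MinCentralOrder.proj {q : ℕ} {v w : Finset (WeilClass q)} (h : v ⊆ w) :
    MinCentralOrder w →+* MinCentralOrder v :=
  Ideal.Quotient.factor (S := RingHom.ker (FrobVer.toProd w))
    (T := RingHom.ker (FrobVer.toProd v))
    (fun _ hx => FrobVer.mem_ker_toProd.2 fun c hc => FrobVer.mem_ker_toProd.1 hx c (h hc))

theorem MinCentralOrder.proj_surjective {q : ℕ} {v w : Finset (WeilClass q)} (h : v ⊆ w) :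
    Function.Surjective (MinCentralOrder.proj h) :=
  Ideal.Quotient.factor_surjective _

theorem MinCentralOrder.proj_self {q : ℕ} {w : Finset (WeilClass q)} (h : w ⊆ w)
    (x : MinCentralOrder w) : MinCentralOrder.proj h x = x := by
  obtain ⟨y, rfl⟩ := Ideal.Quotient.mk_surjective x
  rfl

theorem MinCentralOrder.proj_proj {q : ℕ} {u v w : Finset (WeilClass q)} (huv : u ⊆ v)
    (hvw : v ⊆ w) (huw : u ⊆ w) (x : MinCentralOrder w) :
    MinCentralOrder.proj huv (MinCentralOrder.proj hvw x) = MinCentralOrder.proj huw x := by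
  obtain ⟨y, rfl⟩ := Ideal.Quotient.mk_surjective x
  rfl

/-! ### Modules over the pro-ring of minimal central orders -/

/-- The finite subsets of `W ⊆ W_q`. -/
abbrev FinSub {q : ℕ} (W : Set (WeilClass q)) : Type :=
  {w : Finset (WeilClass q) // (w : Set (WeilClass q)) ⊆ W}

/-- An `R_W`-module: a projective system of `R_w`-modules `M_w`, with `w` ranging over the finite
subsets of `W`, whose transition maps `M_w → M_v` are semilinear over `R_w → R_v`. -/
structure ProModule {q : ℕ} (W : Set (WeilClass q)) where
  /-- The module `M_w`. -/
  obj : FinSub W → Type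
  [addCommGroup : ∀ w, AddCommGroup (obj w)]
  [module : ∀ w, Module (MinCentralOrder w.1) (obj w)]
  /-- The transition map `M_w → M_v` for `v ⊆ w`. -/
  map : ∀ {v w : FinSub W} (h : v.1 ⊆ w.1), obj w →ₛₗ[MinCentralOrder.proj h] obj v
  map_self : ∀ (w : FinSub W) (x : obj w), map (Finset.Subset.refl w.1) x = x
  map_map : ∀ {u v w : FinSub W} (huv : u.1 ⊆ v.1) (hvw : v.1 ⊆ w.1) (x : obj w),
    map huv (map hvw x) = map (huv.trans hvw) x

attribute [instance] ProModule.addCommGroup ProModule.module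

namespace ProModule

variable {q : ℕ} {V W : Set (WeilClass q)}

/-- An isomorphism of `R_W`-modules: levelwise `R_w`-linear isomorphisms that commute with the
transition maps. -/
structure Iso (M N : ProModule W) where
  /-- The isomorphism `M_w ≃ N_w`. -/
  app : ∀ w : FinSub W, M.obj w ≃ₗ[MinCentralOrder w.1] N.obj w
  naturality : ∀ {v w : FinSub W} (h : v.1 ⊆ w.1) (x : M.obj w),
    app v (M.map h x) = N.map h (app w x)

/-- An `R_W`-module is invertible if every `M_w` is an invertible `R_w`-module and the
transition maps are surjective. -/
structure IsInvertible (M : ProModule W) : Prop where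
  invertible : ∀ w : FinSub W, Module.Invertible (MinCentralOrder w.1) (M.obj w)
  surjective : ∀ {v w : FinSub W} (h : v.1 ⊆ w.1), Function.Surjective (M.map h)

/-- The identity isomorphism. -/
def Iso.refl (M : ProModule W) : Iso M M where
  app _ := LinearEquiv.refl _ _
  naturality _ _ := rfl

/-- The inverse isomorphism. -/
def Iso.symm {M N : ProModule W} (e : Iso M N) : Iso N M where
  app w := (e.app w).symm
  naturality h x := by
    rw [LinearEquiv.symm_apply_eq, e.naturality, LinearEquiv.apply_symm_apply]

/-- The composition of isomorphisms. -/
def Iso.trans {M N P : ProModule W} (e : Iso M N) (f : Iso N P) : Iso M P where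
  app w := (e.app w).trans (f.app w)
  naturality h x := by
    rw [LinearEquiv.trans_apply, LinearEquiv.trans_apply, e.naturality, f.naturality]

/-- The `R_W`-module `R_W`. -/
abbrev unit (W : Set (WeilClass q)) : ProModule W where
  obj w := MinCentralOrder w.1
  map h := (MinCentralOrder.proj h).toSemilinearMap
  map_self w x := MinCentralOrder.proj_self (Finset.Subset.refl w.1) x
  map_map huv hvw x := MinCentralOrder.proj_proj huv hvw (huv.trans hvw) x

theorem unit_isInvertible (W : Set (WeilClass q)) : (unit W).IsInvertible where
  invertible w := inferInstanceAs (Module.Invertible (MinCentralOrder w.1) (MinCentralOrder w.1))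
  surjective h := MinCentralOrder.proj_surjective h

/-- The levelwise tensor product `(M_w ⊗ N_w)`. -/
abbrev tensor (M N : ProModule W) : ProModule W where
  obj w := M.obj w ⊗[MinCentralOrder w.1] N.obj w
  map h := TensorProduct.map (M.map h) (N.map h)
  map_self w x := by
    induction x with
    | zero => exact map_zero _
    | tmul x y => rw [TensorProduct.map_tmul, M.map_self, N.map_self]
    | add x y hx hy => rw [map_add, hx, hy]
  map_map huv hvw x := by
    induction x with
    | zero => simp only [map_zero]
    | tmul x y => simp only [TensorProduct.map_tmul, M.map_map, N.map_map]
    | add x y hx hy => simp only [map_add, hx, hy]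

@[simp]
theorem tensor_map_tmul (M N : ProModule W) {v w : FinSub W} (h : v.1 ⊆ w.1) (x : M.obj w)
    (y : N.obj w) :
    (tensor M N).map h (x ⊗ₜ[MinCentralOrder w.1] y) =
      (M.map h x) ⊗ₜ[MinCentralOrder v.1] (N.map h y) := rfl

theorem IsInvertible.tensor {M N : ProModule W} (hM : M.IsInvertible) (hN : N.IsInvertible) :
    (M.tensor N).IsInvertible where
  invertible w := by
    have := hM.invertible w
    have := hN.invertible w
    exact inferInstanceAs
      (Module.Invertible (MinCentralOrder w.1) (M.obj w ⊗[MinCentralOrder w.1] N.obj w))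
  surjective {v w} h y := by
    induction y using TensorProduct.induction_on with
    | zero => exact ⟨0, map_zero _⟩
    | tmul x y =>
      obtain ⟨x, rfl⟩ := hM.surjective h x
      obtain ⟨y, rfl⟩ := hN.surjective h y
      exact ⟨x ⊗ₜ y, rfl⟩
    | add x y hx hy =>
      obtain ⟨x, rfl⟩ := hx
      obtain ⟨y, rfl⟩ := hy
      exact ⟨x + y, map_add _ _ _⟩

/-- A levelwise isomorphism out of a tensor product is natural if it is so on pure tensors. -/
def isoOfTensor {M N P : ProModule W}
    (app : ∀ w : FinSub W, (M.tensor N).obj w ≃ₗ[MinCentralOrder w.1] P.obj w)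
    (hnat : ∀ {v w : FinSub W} (h : v.1 ⊆ w.1) (x : M.obj w) (y : N.obj w),
      app v (M.map h x ⊗ₜ[MinCentralOrder v.1] N.map h y) =
        P.map h (app w (x ⊗ₜ[MinCentralOrder w.1] y))) : Iso (M.tensor N) P where
  app := app
  naturality {v w} h x := by
    induction x using TensorProduct.induction_on with
    | zero => simp only [map_zero]
    | tmul x y => exact hnat h x y
    | add x y hx hy => simp only [map_add, hx, hy]

/-- The tensor product of isomorphisms. -/
def Iso.tensor {M M' N N' : ProModule W} (e : Iso M M') (f : Iso N N') :
    Iso (M.tensor N) (M'.tensor N') :=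
  isoOfTensor (fun w => TensorProduct.congr (e.app w) (f.app w)) fun h x y => by
    simp only [TensorProduct.congr_tmul, TensorProduct.map_tmul, e.naturality, f.naturality]

/-- Commutativity of the tensor product. -/
def tensorComm (M N : ProModule W) : Iso (M.tensor N) (N.tensor M) :=
  isoOfTensor (fun w => TensorProduct.comm (MinCentralOrder w.1) (M.obj w) (N.obj w))
    fun _ _ _ => rfl

/-- Associativity of the tensor product. -/
def tensorAssoc (M N P : ProModule W) :
    Iso ((M.tensor N).tensor P) (M.tensor (N.tensor P)) :=
  isoOfTensor
    (fun w => TensorProduct.assoc (MinCentralOrder w.1) (M.obj w) (N.obj w) (P.obj w))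
    fun h x z => by
      induction x using TensorProduct.induction_on with
      | zero => simp only [TensorProduct.zero_tmul, map_zero]
      | tmul x y => rfl
      | add x y hx hy => simp only [TensorProduct.add_tmul, map_add, hx, hy]

/-- The unit law of the tensor product. -/
def unitTensor (M : ProModule W) : Iso ((unit W).tensor M) M :=
  isoOfTensor (fun w => TensorProduct.lid (MinCentralOrder w.1) (M.obj w))
    fun h r y => ((M.map h).map_smulₛₗ r y).symm

/-- The restriction `M_W ↦ M_W ⊗ R_V = (M_w)`, with `w` ranging over the finite subsets of
`V ⊆ W`. -/
abbrev restrict (h : V ⊆ W) (M : ProModule W) : ProModule V where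
  obj w := M.obj ⟨w.1, w.2.trans h⟩
  addCommGroup w := M.addCommGroup ⟨w.1, w.2.trans h⟩
  module w := M.module ⟨w.1, w.2.trans h⟩
  map {v w} hvw := M.map (v := ⟨v.1, v.2.trans h⟩) (w := ⟨w.1, w.2.trans h⟩) hvw
  map_self _ x := M.map_self _ x
  map_map _ _ x := M.map_map _ _ x

theorem IsInvertible.restrict {M : ProModule W} (hM : M.IsInvertible) (h : V ⊆ W) :
    (M.restrict h).IsInvertible where
  invertible w := hM.invertible ⟨w.1, w.2.trans h⟩
  surjective {v w} hvw := hM.surjective (v := ⟨v.1, v.2.trans h⟩) (w := ⟨w.1, w.2.trans h⟩) hvw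

/-- The restriction of an isomorphism. -/
def Iso.restrict {M N : ProModule W} (e : Iso M N) (h : V ⊆ W) :
    Iso (M.restrict h) (N.restrict h) where
  app w := e.app ⟨w.1, w.2.trans h⟩
  naturality {v w} hvw x :=
    e.naturality (v := ⟨v.1, v.2.trans h⟩) (w := ⟨w.1, w.2.trans h⟩) hvw x

end ProModule

/-! ### Duals -/

section Dual

variable {R S : Type} [CommRing R] [CommRing S] {σ : R →+* S} {M N : Type} [AddCommGroup M]
  [AddCommGroup N] [Module R M] [Module S N] [Module.Invertible R M]

theorem exists_dual_descend [Module.Invertible S N] (f : M →ₛₗ[σ] N) (hf : Function.Surjective f)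
    (φ : Module.Dual R M) : ∃ ψ : Module.Dual S N, ∀ x, ψ (f x) = σ (φ x) := by
  let _ : Algebra R S := σ.toAlgebra
  let _ : Module R N := Module.compHom N σ
  have : IsScalarTower R S N := ⟨fun r s n => by
    change (σ r * s) • n = σ r • (s • n)
    rw [mul_smul]⟩
  let f' : M →ₗ[R] N := { toFun := f, map_add' := map_add f, map_smul' := f.map_smulₛₗ }
  let g : S ⊗[R] M →ₗ[S] N := LinearMap.liftBaseChange S f'
  have hg : Function.Bijective g := by
    apply Module.Invertible.bijective_of_surjective
    intro n
    obtain ⟨x, rfl⟩ := hf n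
    exact ⟨1 ⊗ₜ x, by simp [g, f']⟩
  let e := LinearEquiv.ofBijective g hg
  let k : S ⊗[R] M →ₗ[S] S := LinearMap.liftBaseChange S ((Algebra.linearMap R S) ∘ₗ φ)
  refine ⟨k ∘ₗ e.symm.toLinearMap, fun x => ?_⟩
  have h1 : e.symm (f x) = 1 ⊗ₜ x := by
    rw [LinearEquiv.symm_apply_eq]
    simp [e, g, f']
  simp only [LinearMap.comp_apply, LinearEquiv.coe_coe, h1]
  simp only [k, LinearMap.liftBaseChange_tmul, one_smul, LinearMap.comp_apply]
  rfl

theorem exists_dual_lift (hσ : Function.Surjective σ) (f : M →ₛₗ[σ] N)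
    (ψ : Module.Dual S N) : ∃ φ : Module.Dual R M, ∀ x, ψ (f x) = σ (φ x) := by
  let _ : Algebra R S := σ.toAlgebra
  let k : M →ₗ[R] S :=
    { toFun := fun x => ψ (f x)
      map_add' := fun x y => by rw [map_add, map_add]
      map_smul' := fun r x => by
        rw [f.map_smulₛₗ, map_smul]
        rfl }
  obtain ⟨φ, hφ⟩ := Module.projective_lifting_property (Algebra.linearMap R S) k hσ
  exact ⟨φ, fun x => (LinearMap.congr_fun hφ x).symm⟩

end Dual

namespace ProModule

variable {q : ℕ} {V W : Set (WeilClass q)}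

theorem IsInvertible.exists_dual_descend {M : ProModule W} (hM : M.IsInvertible) {v w : FinSub W}
    (h : v.1 ⊆ w.1) (φ : Module.Dual (MinCentralOrder w.1) (M.obj w)) :
    ∃ ψ : Module.Dual (MinCentralOrder v.1) (M.obj v),
      ∀ x, ψ (M.map h x) = MinCentralOrder.proj h (φ x) := by
  have := hM.invertible w
  have := hM.invertible v
  exact _root_.exists_dual_descend (M.map h) (hM.surjective h) φ

/-- The functional on `M_v` induced by a functional on `M_w`, for `v ⊆ w`. -/
def IsInvertible.dualMap {M : ProModule W} (hM : M.IsInvertible) {v w : FinSub W}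
    (h : v.1 ⊆ w.1) (φ : Module.Dual (MinCentralOrder w.1) (M.obj w)) :
    Module.Dual (MinCentralOrder v.1) (M.obj v) :=
  (hM.exists_dual_descend h φ).choose

theorem IsInvertible.dualMap_apply {M : ProModule W} (hM : M.IsInvertible) {v w : FinSub W}
    (h : v.1 ⊆ w.1) (φ : Module.Dual (MinCentralOrder w.1) (M.obj w)) (x : M.obj w) :
    hM.dualMap h φ (M.map h x) = MinCentralOrder.proj h (φ x) :=
  (hM.exists_dual_descend h φ).choose_spec x

theorem IsInvertible.dualMap_unique {M : ProModule W} (hM : M.IsInvertible) {v w : FinSub W}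
    (h : v.1 ⊆ w.1) (φ : Module.Dual (MinCentralOrder w.1) (M.obj w))
    (ψ : Module.Dual (MinCentralOrder v.1) (M.obj v))
    (hψ : ∀ x, ψ (M.map h x) = MinCentralOrder.proj h (φ x)) : hM.dualMap h φ = ψ := by
  ext y
  obtain ⟨x, rfl⟩ := hM.surjective h y
  rw [hM.dualMap_apply, hψ]

/-- The levelwise dual of an invertible `R_W`-module. -/
abbrev IsInvertible.dual {M : ProModule W} (hM : M.IsInvertible) : ProModule W where
  obj w := Module.Dual (MinCentralOrder w.1) (M.obj w)
  map h :=
    { toFun := hM.dualMap h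
      map_add' := fun φ φ' => hM.dualMap_unique h _ _ fun x => by
        simp only [LinearMap.add_apply, hM.dualMap_apply, map_add]
      map_smul' := fun r φ => hM.dualMap_unique h _ _ fun x => by
        simp only [LinearMap.smul_apply, hM.dualMap_apply, smul_eq_mul, map_mul] }
  map_self w φ := hM.dualMap_unique _ _ _ fun x => by
    rw [M.map_self, MinCentralOrder.proj_self]
  map_map huv hvw φ := (hM.dualMap_unique (huv.trans hvw) _ _ fun x => by
    rw [← M.map_map huv hvw x]
    change hM.dualMap huv (hM.dualMap hvw φ) _ = _
    rw [hM.dualMap_apply, hM.dualMap_apply, MinCentralOrder.proj_proj]).symm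

theorem IsInvertible.dual_isInvertible {M : ProModule W} (hM : M.IsInvertible) :
    hM.dual.IsInvertible where
  invertible w := by
    have := hM.invertible w
    exact inferInstanceAs
      (Module.Invertible (MinCentralOrder w.1) (Module.Dual (MinCentralOrder w.1) (M.obj w)))
  surjective {v w} h ψ := by
    have := hM.invertible w
    have := hM.invertible v
    obtain ⟨φ, hφ⟩ := exists_dual_lift (MinCentralOrder.proj_surjective h) (M.map h) ψ
    exact ⟨φ, hM.dualMap_unique h φ ψ hφ⟩

/-- The contraction of the levelwise dual with `M`. -/
def IsInvertible.contract {M : ProModule W} (hM : M.IsInvertible) :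
    Iso (hM.dual.tensor M) (unit W) :=
  isoOfTensor
    (fun w => LinearEquiv.ofBijective (contractLeft (MinCentralOrder w.1) (M.obj w))
      (hM.invertible w).bijective)
    fun h φ y => hM.dualMap_apply h φ y

end ProModule

/-! ### The Picard group -/

/-- The invertible `R_W`-modules. -/
def InvertibleProModule {q : ℕ} (W : Set (WeilClass q)) : Type 1 :=
  {M : ProModule W // M.IsInvertible}

/-- Isomorphism as an equivalence relation on the invertible `R_W`-modules. -/
instance InvertibleProModule.setoid {q : ℕ} (W : Set (WeilClass q)) :
    Setoid (InvertibleProModule W) where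
  r M N := Nonempty (ProModule.Iso M.1 N.1)
  iseqv :=
    { refl := fun _ => ⟨ProModule.Iso.refl _⟩
      symm := fun ⟨e⟩ => ⟨e.symm⟩
      trans := fun ⟨e⟩ ⟨f⟩ => ⟨e.trans f⟩ }

/-- The set of isomorphism classes of invertible `R_W`-modules. -/
def ProPic {q : ℕ} (W : Set (WeilClass q)) : Type 1 :=
  Quotient (InvertibleProModule.setoid W)

namespace ProPic

variable {q : ℕ} {V W : Set (WeilClass q)}

/-- The class of an invertible `R_W`-module. -/
def mk (M : ProModule W) (hM : M.IsInvertible) : ProPic W :=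
  Quotient.mk _ ⟨M, hM⟩

theorem mk_eq_mk_iff {M N : ProModule W} {hM : M.IsInvertible} {hN : N.IsInvertible} :
    mk M hM = mk N hN ↔ Nonempty (ProModule.Iso M N) :=
  Quotient.eq

theorem exists_mk (a : ProPic W) : ∃ (M : ProModule W) (hM : M.IsInvertible), mk M hM = a := by
  obtain ⟨⟨M, hM⟩, rfl⟩ := Quotient.exists_rep a
  exact ⟨M, hM, rfl⟩

/-- The group structure on the Picard group: the product is the levelwise tensor product, the
unit is the class of `R_W` and the inverse is the levelwise dual. -/
instance : CommGroup (ProPic W) where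
  mul := Quotient.map₂ (fun M N => ⟨M.1.tensor N.1, M.2.tensor N.2⟩)
    (fun _ _ ⟨e⟩ _ _ ⟨f⟩ => ⟨e.tensor f⟩)
  one := mk (ProModule.unit W) (ProModule.unit_isInvertible W)
  inv := fun a => mk _ (Quotient.out a).2.dual_isInvertible
  mul_assoc := by
    rintro ⟨M⟩ ⟨N⟩ ⟨P⟩
    exact Quotient.sound ⟨ProModule.tensorAssoc M.1 N.1 P.1⟩
  one_mul := by
    rintro ⟨M⟩
    exact Quotient.sound ⟨ProModule.unitTensor M.1⟩
  mul_one := by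
    rintro ⟨M⟩
    exact Quotient.sound ⟨(ProModule.tensorComm _ _).trans (ProModule.unitTensor M.1)⟩
  mul_comm := by
    rintro ⟨M⟩ ⟨N⟩
    exact Quotient.sound ⟨ProModule.tensorComm M.1 N.1⟩
  inv_mul_cancel a := by
    conv_lhs => arg 2; rw [← Quotient.out_eq a]
    exact Quotient.sound ⟨(Quotient.out a).2.contract⟩

theorem mk_mul_mk {M N : ProModule W} (hM : M.IsInvertible) (hN : N.IsInvertible) :
    mk M hM * mk N hN = mk (M.tensor N) (hM.tensor hN) := rfl

/-- The restriction homomorphism `Pic(R_W) → Pic(R_V)` for `V ⊆ W`. -/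
def restrict (h : V ⊆ W) : ProPic W →* ProPic V where
  toFun := Quotient.map (fun M => ⟨M.1.restrict h, M.2.restrict h⟩)
    (fun _ _ ⟨e⟩ => ⟨e.restrict h⟩)
  map_one' := Quotient.sound ⟨ProModule.Iso.refl (ProModule.unit V)⟩
  map_mul' := by
    rintro ⟨M⟩ ⟨N⟩
    exact Quotient.sound ⟨ProModule.Iso.refl ((M.1.restrict h).tensor (N.1.restrict h))⟩

theorem restrict_mk (h : V ⊆ W) {M : ProModule W} (hM : M.IsInvertible) :
    restrict h (mk M hM) = mk (M.restrict h) (hM.restrict h) := rfl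

end ProPic

end

noncomputable section

/-! ### Invertible modules over quotient rings -/

section Line

variable {A : Type*} [CommRing A]

/-! Write `A = ℤ[F, V] / (F V - q)` and `R_w = A ⧸ I_w`. All modules are treated as `A`-modules, so
that invertible modules over different `R_w` can be compared without base change: an `I`-line is an
invertible `A ⧸ I`-module in this guise. The condition `φ x • y = φ y • x` says that `x` generates
wherever `φ x` is invertible, so a line is locally free of rank one; local arguments become
membership of `1` in an ideal of denominators.

The heart is the extension step `exists_extension`. Let `v ⊆ w`, and let `N` be an `R_v`-line with a
surjection onto `M_{v ∩ V}`. It must be glued to `M_{w ∩ V}`. Milnor patching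
(`IsLine.fiberProduct`) would do this given isomorphic reductions modulo `I_v + I_{w ∩ V}`, but only
an identification modulo the possibly larger ideal `I_{v ∩ V}` is available. The two loci differ at
finitely many maximal ideals only (`FrobVer.finite_isMaximal`): kernels of non-conjugate Weil
numbers are incomparable primes with quotients finite over `ℤ`, so the sum of two of them has finite
index. Since lines are projective, the identification lifts to a linear map modulo the sum, and this
map can be corrected at the finitely many remaining points without changing it modulo `I_{v ∩ V}`
(`IsLine.exists_surjective`). Classes of `w` not yet reached are added by patching with a free line.

As `W_q` is countable, it is exhausted by a sequence of finite sets. Iterating the extension step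
gives a tower of lines with surjective transition maps. Its limit `X` surjects onto every stage, and
suitable quotients of `X` form an invertible system over all of `W_q`, hence over `W`, that
restricts to `M` over `V`. -/

/-- The local-global principle used throughout: `c` will be the ideal of those `a` for which a claim
holds after multiplication by `a`. Only maximal ideals above `I` can contain `c`. -/
theorem Ideal.eq_top_of_forall_isMaximal {I c : Ideal A} (hI : I ≤ c)
    (h : ∀ m : Ideal A, m.IsMaximal → I ≤ m → ∃ a ∈ c, a ∉ m) : c = ⊤ := by
  by_contra hc
  obtain ⟨m, hm, hcm⟩ := Ideal.exists_le_maximal c hc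
  obtain ⟨a, hac, ham⟩ := h m hm (hI.trans hcm)
  exact ham (hcm hac)

/-- A functional `φ : L → A ⧸ I` on a module killed by `I` is a coordinate if
`φ x • y = φ y • x` for all `x` and `y`. -/
def IsCoordinate {I : Ideal A} {L : Type*} [AddCommGroup L] [Module A L]
    (φ : L →ₗ[A] A ⧸ I) : Prop :=
  ∀ (x y : L) (a b : A), Ideal.Quotient.mk I a = φ x → Ideal.Quotient.mk I b = φ y → a • y = b • x

/-- An `A`-module is an `I`-line if it is an invertible `A ⧸ I`-module, that is, it is killed by
`I` and the values of its coordinates generate `A ⧸ I`. -/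
structure IsLine (I : Ideal A) (L : Type*) [AddCommGroup L] [Module A L] : Prop where
  smul_eq_zero : ∀ a ∈ I, ∀ x : L, a • x = 0
  exists_coordinate : ∀ m : Ideal A, m.IsMaximal → I ≤ m →
    ∃ (φ : L →ₗ[A] A ⧸ I) (x : L) (a : A), IsCoordinate φ ∧ a ∉ m ∧ Ideal.Quotient.mk I a = φ x

variable {I J K S m : Ideal A} {L N M T P : Type*} [AddCommGroup L] [Module A L]
  [AddCommGroup N] [Module A N] [AddCommGroup M] [Module A M] [AddCommGroup T] [Module A T]
  [AddCommGroup P] [Module A P]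

theorem IsLine.of_linearEquiv (hL : IsLine I L) (e : L ≃ₗ[A] M) : IsLine I M where
  smul_eq_zero a ha x := by
    rw [← e.apply_symm_apply x, ← map_smul, hL.smul_eq_zero a ha, map_zero]
  exists_coordinate m hm hIm := by
    obtain ⟨φ, x, a, hφ, ha, hax⟩ := hL.exists_coordinate m hm hIm
    refine ⟨φ ∘ₗ e.symm.toLinearMap, e x, a, fun x y b c hb hc => ?_, ha, by simpa using hax⟩
    apply e.symm.injective
    simpa using hφ _ _ _ _ hb hc

theorem isLine_top [Subsingleton L] : IsLine (⊤ : Ideal A) L where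
  smul_eq_zero _ _ _ := Subsingleton.elim _ _
  exists_coordinate _ hm h := absurd (top_le_iff.1 h) hm.ne_top

theorem isLine_quotient (I : Ideal A) : IsLine I (A ⧸ I) where
  smul_eq_zero a ha x := by
    obtain ⟨x, rfl⟩ := Ideal.Quotient.mk_surjective x
    rw [← Ideal.Quotient.mk_eq_mk, ← Submodule.Quotient.mk_smul, Submodule.Quotient.mk_eq_zero]
    exact I.mul_mem_right _ ha
  exists_coordinate m hm hIm := by
    refine ⟨LinearMap.id, 1, 1, fun x y a b ha hb => ?_, fun h => hm.ne_top ((m.eq_top_iff_one).2 h),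
      rfl⟩
    obtain rfl : _ = x := ha
    obtain rfl : _ = y := hb
    change Ideal.Quotient.mk I (a * b) = Ideal.Quotient.mk I (b * a)
    rw [mul_comm]

/-- The map `A ⧸ I → L` with `1 ↦ z`, for a module `L` killed by `I`. -/
def quotientToSpan (h : ∀ a ∈ I, ∀ x : L, a • x = 0) (z : L) : (A ⧸ I) →ₗ[A] L :=
  Submodule.liftQ I (LinearMap.toSpanSingleton A L z) fun a ha => h a ha z

theorem quotientToSpan_mk (h : ∀ a ∈ I, ∀ x : L, a • x = 0) (z : L) (a : A) :
    quotientToSpan h z (Ideal.Quotient.mk I a) = a • z := rfl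

theorem IsLine.eq_zero (hL : IsLine I L) {z : L}
    (h : ∀ m : Ideal A, m.IsMaximal → I ≤ m → ∃ a, a ∉ m ∧ a • z = 0) : z = 0 := by
  have h1 : LinearMap.ker (LinearMap.toSpanSingleton A L z) = ⊤ :=
    Ideal.eq_top_of_forall_isMaximal (fun a ha => hL.smul_eq_zero a ha z) fun m hm hIm =>
      let ⟨a, ha, haz⟩ := h m hm hIm
      ⟨a, haz, ha⟩
  have h2 : (1 : A) ∈ LinearMap.ker (LinearMap.toSpanSingleton A L z) := h1 ▸ Submodule.mem_top
  simpa using h2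

/-- Every functional on a line is a coordinate. -/
theorem IsLine.isCoordinate (hL : IsLine I L) (ψ : L →ₗ[A] A ⧸ I) : IsCoordinate ψ := by
  intro y z s t hs ht
  rw [← sub_eq_zero]
  refine hL.eq_zero fun m hm hIm => ?_
  obtain ⟨φ, x, a, hφ, ha, hax⟩ := hL.exists_coordinate m hm hIm
  refine ⟨a, ha, ?_⟩
  obtain ⟨b, hb⟩ := Ideal.Quotient.mk_surjective (φ y)
  obtain ⟨c, hc⟩ := Ideal.Quotient.mk_surjective (φ z)
  -- Apply `ψ` to `b • z = c • y`. Since `a • y = b • x` and `a • z = c • x`, the difference to be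
  -- killed becomes a multiple of `x` by this element.
  have h1 : b * t - c * s ∈ I := by
    rw [← Ideal.Quotient.eq_zero_iff_mem, map_sub, map_mul, map_mul, ht, hs, sub_eq_zero]
    have := congrArg ψ (hφ y z b c hb hc)
    rwa [map_smul, map_smul] at this
  have h2 := hL.smul_eq_zero _ h1 x
  have h3 := hφ x y a b hax hb
  have h4 := hφ x z a c hax hc
  calc a • (s • z - t • y) = s • (a • z) - t • (a • y) := by module
    _ = -((b * t - c * s) • x) := by rw [h3, h4]; module
    _ = 0 := by rw [h2, neg_zero]

/-- Lines are faithful over `A ⧸ I`: if `b` kills `L`, it kills all values of functionals, and these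
generate `A ⧸ I`. -/
theorem IsLine.mem_of_smul_eq_zero (hL : IsLine I L) {b : A} (h : ∀ x : L, b • x = 0) : b ∈ I := by
  have h1 : I.colon {b} = ⊤ := by
    refine Ideal.eq_top_of_forall_isMaximal (I := I) ?_ fun m hm hIm => ?_
    · intro a ha
      rw [Submodule.mem_colon_singleton]
      exact I.mul_mem_right _ ha
    · obtain ⟨φ, x, a, hφ, ha, hax⟩ := hL.exists_coordinate m hm hIm
      refine ⟨a, ?_, ha⟩
      rw [Submodule.mem_colon_singleton, smul_eq_mul, mul_comm, ← Ideal.Quotient.eq_zero_iff_mem,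
        map_mul, hax]
      have := congrArg φ (h x)
      rwa [map_smul, map_zero] at this
  have h2 : (1 : A) ∈ I.colon {b} := h1 ▸ Submodule.mem_top
  rw [Submodule.mem_colon_singleton] at h2
  simpa using h2

theorem Ideal.IsMaximal.mem_smul_top_of_smul_mem (hm : m.IsMaximal) {a : A} (ha : a ∉ m) {x : L}
    (h : a • x ∈ m • (⊤ : Submodule A L)) : x ∈ m • (⊤ : Submodule A L) := by
  obtain ⟨c, hc⟩ := hm.exists_inv ha
  obtain ⟨i, hi, hci⟩ := hc
  have : x = c • (a • x) + i • x := by rw [smul_smul, ← add_smul, hci, one_smul]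
  rw [this]
  exact Submodule.add_mem _ (Submodule.smul_mem _ _ h)
    (Submodule.smul_mem_smul hi Submodule.mem_top)

theorem Submodule.map_mem_smul_top (f : N →ₗ[A] L) {x : N} (hx : x ∈ I • (⊤ : Submodule A N)) :
    f x ∈ I • (⊤ : Submodule A L) := by
  have h := Submodule.mem_map_of_mem (f := f) hx
  rw [Submodule.map_smul''] at h
  exact Submodule.smul_mono le_rfl le_top h

theorem IsLine.exists_notMem_smul_top (hL : IsLine I L) (hm : m.IsMaximal) (hIm : I ≤ m) :
    ∃ x : L, x ∉ m • (⊤ : Submodule A L) := by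
  obtain ⟨φ, x, a, hφ, ha, hax⟩ := hL.exists_coordinate m hm hIm
  refine ⟨x, fun hx => ha ?_⟩
  have h1 := Submodule.map_mem_smul_top φ hx
  rw [← hax] at h1
  have h2 : m • (⊤ : Submodule A (A ⧸ I)) ≤ LinearMap.ker (Submodule.factor hIm) := by
    rw [Submodule.smul_le]
    intro r hr n _
    obtain ⟨n, rfl⟩ := Submodule.Quotient.mk_surjective _ n
    rw [LinearMap.mem_ker, map_smul]
    change Submodule.Quotient.mk (r • n) = _
    rw [Submodule.Quotient.mk_eq_zero]
    exact m.mul_mem_right _ hr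
  exact Ideal.Quotient.eq_zero_iff_mem.1 (h2 h1)

/-- A form of Nakayama's lemma. If `f y` is nonzero in the fibre at `m`, its coordinate `b` is
outside `m`, and `b • z` is a multiple of `f y` for every `z`. -/
theorem IsLine.surjective (hL : IsLine I L) (f : M →ₗ[A] L)
    (h : ∀ m : Ideal A, m.IsMaximal → I ≤ m → ∃ y, f y ∉ m • (⊤ : Submodule A L)) :
    Function.Surjective f := by
  intro z
  have h1 : (LinearMap.range f).comap (LinearMap.toSpanSingleton A L z) = ⊤ := by
    refine Ideal.eq_top_of_forall_isMaximal (I := I) ?_ fun m hm hIm => ?_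
    · intro a ha
      rw [Submodule.mem_comap, LinearMap.toSpanSingleton_apply, hL.smul_eq_zero a ha]
      exact Submodule.zero_mem _
    · obtain ⟨y, hy⟩ := h m hm hIm
      obtain ⟨φ, x, a, hφ, ha, hax⟩ := hL.exists_coordinate m hm hIm
      obtain ⟨b, hb⟩ := Ideal.Quotient.mk_surjective (φ (f y))
      obtain ⟨c, hc⟩ := Ideal.Quotient.mk_surjective (φ z)
      refine ⟨b, ?_, fun hbm => hy (hm.mem_smul_top_of_smul_mem ha ?_)⟩
      · rw [Submodule.mem_comap, LinearMap.toSpanSingleton_apply, hφ (f y) z b c hb hc]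
        exact ⟨c • y, map_smul f c y⟩
      · rw [hφ x (f y) a b hax hb]
        exact Submodule.smul_mem_smul hbm Submodule.mem_top
  have h2 : (1 : A) ∈ (LinearMap.range f).comap (LinearMap.toSpanSingleton A L z) :=
    h1 ▸ Submodule.mem_top
  simpa using h2

/-- A surjection of lines is reduction modulo `J`. If `f y = 0`, the coordinate `b` of `y` satisfies
`b • z = c • y`, so it kills the image `L` and lies in `J` by faithfulness. -/
theorem IsLine.ker_eq (hN : IsLine I N) (hL : IsLine J L) (hIJ : I ≤ J) {f : N →ₗ[A] L}
    (hf : Function.Surjective f) : LinearMap.ker f = J • (⊤ : Submodule A N) := by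
  apply le_antisymm
  · intro y hy
    have h1 : (J • (⊤ : Submodule A N)).comap (LinearMap.toSpanSingleton A N y) = ⊤ := by
      refine Ideal.eq_top_of_forall_isMaximal (I := I) ?_ fun m hm hIm => ?_
      · intro a ha
        exact Submodule.smul_mem_smul (hIJ ha) Submodule.mem_top
      · obtain ⟨φ, x, a, hφ, ha, hax⟩ := hN.exists_coordinate m hm hIm
        obtain ⟨b, hb⟩ := Ideal.Quotient.mk_surjective (φ y)
        refine ⟨a, ?_, ha⟩
        rw [Submodule.mem_comap, LinearMap.toSpanSingleton_apply, hφ x y a b hax hb]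
        refine Submodule.smul_mem_smul (hL.mem_of_smul_eq_zero fun z => ?_) Submodule.mem_top
        obtain ⟨z, rfl⟩ := hf z
        obtain ⟨c, hc⟩ := Ideal.Quotient.mk_surjective (φ z)
        rw [← map_smul, hφ y z b c hb hc, map_smul, LinearMap.mem_ker.1 hy, smul_zero]
    have h2 : (1 : A) ∈ (J • (⊤ : Submodule A N)).comap (LinearMap.toSpanSingleton A N y) :=
      h1 ▸ Submodule.mem_top
    simpa using h2
  · rw [Submodule.smul_le]
    intro a ha x _
    rw [LinearMap.mem_ker, map_smul, hL.smul_eq_zero a ha]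

theorem quotient_factor_mk (hIJ : I ≤ J) (a : A) :
    Submodule.factor hIJ (Ideal.Quotient.mk I a) = Ideal.Quotient.mk J a := rfl

theorem exists_descend (hIJ : I ≤ J) {f : N →ₗ[A] L} (hf : Function.Surjective f)
    (hker : LinearMap.ker f = J • (⊤ : Submodule A N)) (φ : N →ₗ[A] A ⧸ I) :
    ∃ ψ : L →ₗ[A] A ⧸ J, ∀ x, ψ (f x) = Submodule.factor hIJ (φ x) := by
  have h : LinearMap.ker f ≤ LinearMap.ker (Submodule.factor hIJ ∘ₗ φ) := by
    rw [hker, Submodule.smul_le]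
    intro a ha x _
    rw [LinearMap.mem_ker, map_smul]
    exact (isLine_quotient J).smul_eq_zero a ha _
  refine ⟨(LinearMap.ker f).liftQ _ h ∘ₗ (f.quotKerEquivOfSurjective hf).symm.toLinearMap,
    fun x => ?_⟩
  rw [LinearMap.comp_apply, LinearEquiv.coe_coe, LinearMap.quotKerEquivOfSurjective_symm_apply]
  rfl

theorem IsLine.of_surjective (hN : IsLine I N) (hIJ : I ≤ J) {f : N →ₗ[A] L}
    (hf : Function.Surjective f) (hker : LinearMap.ker f = J • (⊤ : Submodule A N)) :
    IsLine J L := by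
  have hzero : ∀ a ∈ J, ∀ x : L, a • x = 0 := by
    intro a ha x
    obtain ⟨x, rfl⟩ := hf x
    rw [← map_smul, ← LinearMap.mem_ker, hker]
    exact Submodule.smul_mem_smul ha Submodule.mem_top
  refine ⟨hzero, fun m hm hJm => ?_⟩
  obtain ⟨φ, x, a, hφ, ha, hax⟩ := hN.exists_coordinate m hm (hIJ.trans hJm)
  obtain ⟨ψ, hψ⟩ := exists_descend hIJ hf hker φ
  refine ⟨ψ, f x, a, ?_, ha, by rw [hψ, ← hax, quotient_factor_mk]⟩
  intro y z b c hb hc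
  obtain ⟨y, rfl⟩ := hf y
  obtain ⟨z, rfl⟩ := hf z
  obtain ⟨b', hb'⟩ := Ideal.Quotient.mk_surjective (φ y)
  obtain ⟨c', hc'⟩ := Ideal.Quotient.mk_surjective (φ z)
  rw [hψ, ← hb', quotient_factor_mk, Ideal.Quotient.eq] at hb
  rw [hψ, ← hc', quotient_factor_mk, Ideal.Quotient.eq] at hc
  have h1 := congrArg f (hφ y z b' c' hb' hc')
  rw [map_smul, map_smul] at h1
  have h2 := hzero _ hb (f z)
  have h3 := hzero _ hc (f y)
  rw [sub_smul, sub_eq_zero] at h2 h3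
  rw [h2, h1, h3]

theorem IsLine.quotient (hN : IsLine I N) (hIJ : I ≤ J) :
    IsLine J (N ⧸ J • (⊤ : Submodule A N)) :=
  hN.of_surjective hIJ (Submodule.mkQ_surjective _) (Submodule.ker_mkQ _)

/-- Lines are projective. -/
theorem IsLine.exists_lift (hM : IsLine J M) (hN : ∀ a ∈ J, ∀ x : N, a • x = 0) {g : N →ₗ[A] L}
    (hg : Function.Surjective g) (h : M →ₗ[A] L) : ∃ k : M →ₗ[A] N, g ∘ₗ k = h := by
  let c : Ideal A := (LinearMap.range (LinearMap.compRight A (M := M) g)).comap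
    (LinearMap.toSpanSingleton A _ h)
  have hc : c = ⊤ := by
    refine Ideal.eq_top_of_forall_isMaximal (I := J) ?_ fun m hm hJm => ?_
    · intro a ha
      refine ⟨0, ?_⟩
      ext x
      change g 0 = a • h x
      rw [← map_smul, hM.smul_eq_zero a ha, map_zero, map_zero]
    · obtain ⟨φ, x, a, hφ, ha, hax⟩ := hM.exists_coordinate m hm hJm
      obtain ⟨z, hz⟩ := hg (h x)
      -- The map `y ↦ φ y • z` lifts `a • h`, because `φ y • h x = h (a • y)`.
      refine ⟨a, ⟨quotientToSpan hN z ∘ₗ φ, ?_⟩, ha⟩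
      ext y
      obtain ⟨b, hb⟩ := Ideal.Quotient.mk_surjective (φ y)
      change g (quotientToSpan hN z (φ y)) = a • h y
      rw [← hb, quotientToSpan_mk, map_smul, hz, ← map_smul, ← map_smul, hφ x y a b hax hb]
  have h1 : (1 : A) ∈ c := hc ▸ Submodule.mem_top
  obtain ⟨k, hk⟩ := h1
  refine ⟨k, ?_⟩
  rw [LinearMap.toSpanSingleton_apply, one_smul] at hk
  exact hk

end Line

/-! ### Milnor patching and correction at finitely many points -/

section Line

variable {A : Type*} [CommRing A] {I J K S m : Ideal A} {L N M T P : Type*}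
  [AddCommGroup L] [Module A L] [AddCommGroup N] [Module A N] [AddCommGroup M] [Module A M]
  [AddCommGroup T] [Module A T] [AddCommGroup P] [Module A P]

/-- Compatible functionals glue because `A ⧸ (I ⊓ J)` is the fibre product of `A ⧸ I` and `A ⧸ J`
over `A ⧸ (I ⊔ J)`. Naming the infimum `K` and the supremum `S` lets `I` and `J` be exchanged later.
-/
theorem exists_toQuotientInf (hK : I ⊓ J = K) (hIS : I ≤ S) (hJS : J ≤ S) (hS : S ≤ I ⊔ J)
    (α : P →ₗ[A] A ⧸ I) (β : P →ₗ[A] A ⧸ J)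
    (h : ∀ p, Submodule.factor hIS (α p) = Submodule.factor hJS (β p)) :
    ∃ φ : P →ₗ[A] A ⧸ K, ∀ (p : P) (a : A), Ideal.Quotient.mk K a = φ p →
      Ideal.Quotient.mk I a = α p ∧ Ideal.Quotient.mk J a = β p := by
  have hKI : K ≤ I := hK ▸ inf_le_left
  have hKJ : K ≤ J := hK ▸ inf_le_right
  let D : (A ⧸ K) →ₗ[A] (A ⧸ I) × (A ⧸ J) :=
    (Submodule.factor hKI).prod (Submodule.factor hKJ)
  have hD : Function.Injective D := by
    rw [← LinearMap.ker_eq_bot, LinearMap.ker_eq_bot']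
    intro x hx
    obtain ⟨a, rfl⟩ := Ideal.Quotient.mk_surjective x
    have h1 := congrArg Prod.fst hx
    have h2 := congrArg Prod.snd hx
    rw [Ideal.Quotient.eq_zero_iff_mem, ← hK]
    exact ⟨Ideal.Quotient.eq_zero_iff_mem.1 h1, Ideal.Quotient.eq_zero_iff_mem.1 h2⟩
  have hrange : ∀ p, (α.prod β) p ∈ LinearMap.range D := by
    intro p
    obtain ⟨a, ha⟩ := Ideal.Quotient.mk_surjective (α p)
    obtain ⟨b, hb⟩ := Ideal.Quotient.mk_surjective (β p)
    have h1 := h p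
    rw [← ha, ← hb, quotient_factor_mk, quotient_factor_mk, Ideal.Quotient.eq] at h1
    obtain ⟨i, hi, j, hj, hij⟩ := Submodule.mem_sup.1 (hS h1)
    refine ⟨Ideal.Quotient.mk K (a - i), Prod.ext ?_ ?_⟩
    · change Ideal.Quotient.mk I (a - i) = α p
      rw [← ha, Ideal.Quotient.eq]
      simpa using hi
    · change Ideal.Quotient.mk J (a - i) = β p
      rw [← hb, Ideal.Quotient.eq]
      have : a - i - b = j := by linear_combination -hij
      rwa [this]
  refine ⟨(LinearEquiv.ofInjective D hD).symm.toLinearMap ∘ₗ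
    (α.prod β).codRestrict (LinearMap.range D) hrange, fun p a ha => ?_⟩
  have h1 : D (Ideal.Quotient.mk K a) = (α.prod β) p := by
    rw [ha, LinearMap.comp_apply, LinearEquiv.coe_coe]
    exact congrArg Subtype.val ((LinearEquiv.ofInjective D hD).apply_symm_apply
      ((α.prod β).codRestrict (LinearMap.range D) hrange p))
  exact ⟨congrArg Prod.fst h1, congrArg Prod.snd h1⟩

/-- A coordinate `α` of `N` near `m` descends to `L`; projectivity of `M` lifts its pullback along
`g` to `β` on `M`, and `α`, `β` glue. Nothing is asked of `β` at `m`: as `I ≤ m`, the value modulo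
`m` is read off from `α`. -/
theorem exists_coordinate_of_fiberProduct (hN : IsLine I N) (hM : IsLine J M) (hL : IsLine S L)
    (hK : I ⊓ J = K) (hIS : I ≤ S) (hJS : J ≤ S) (hS : S ≤ I ⊔ J) {f : N →ₗ[A] L}
    {g : M →ₗ[A] L} (hf : Function.Surjective f) (hg : Function.Surjective g) (r : P →ₗ[A] N)
    (s : P →ₗ[A] M) (hrs : ∀ p, f (r p) = g (s p))
    (hinj : ∀ p p', r p = r p' → s p = s p' → p = p')
    (hsurj : ∀ x y, f x = g y → ∃ p, r p = x ∧ s p = y) (hm : m.IsMaximal) (hIm : I ≤ m) :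
    ∃ (φ : P →ₗ[A] A ⧸ K) (x : P) (a : A),
      IsCoordinate φ ∧ a ∉ m ∧ Ideal.Quotient.mk K a = φ x := by
  obtain ⟨α, x, a, hα, ha, hax⟩ := hN.exists_coordinate m hm hIm
  obtain ⟨γ, hγ⟩ := exists_descend hIS hf (hN.ker_eq hL hIS hf) α
  obtain ⟨β, hβ⟩ := hM.exists_lift (isLine_quotient J).smul_eq_zero
    (Submodule.factor_surjective hJS) (γ ∘ₗ g)
  have hβ' : ∀ y, Submodule.factor hJS (β y) = γ (g y) := LinearMap.congr_fun hβ
  obtain ⟨φ, hφ⟩ := exists_toQuotientInf hK hIS hJS hS (α ∘ₗ r) (β ∘ₗ s) fun p => by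
    rw [LinearMap.comp_apply, LinearMap.comp_apply, hβ', ← hrs, hγ]
  obtain ⟨y, hy⟩ := hg (f x)
  obtain ⟨p, hpx, hpy⟩ := hsurj x y hy.symm
  obtain ⟨b, hb⟩ := Ideal.Quotient.mk_surjective (φ p)
  refine ⟨φ, p, b, fun p p' a b ha hb => ?_, fun hbm => ha ?_, hb⟩
  · obtain ⟨ha1, ha2⟩ := hφ p a ha
    obtain ⟨hb1, hb2⟩ := hφ p' b hb
    apply hinj
    · rw [map_smul, map_smul]
      exact hα _ _ _ _ ha1 hb1
    · rw [map_smul, map_smul]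
      exact hM.isCoordinate β _ _ _ _ ha2 hb2
  · have h1 := (hφ p b hb).1
    rw [LinearMap.comp_apply, hpx, ← hax, eq_comm, Ideal.Quotient.eq] at h1
    simpa using m.add_mem (hIm h1) hbm

/-- Milnor patching for lines. -/
theorem IsLine.fiberProduct (hN : IsLine I N) (hM : IsLine J M) (hL : IsLine (I ⊔ J) L)
    {f : N →ₗ[A] L} {g : M →ₗ[A] L} (hf : Function.Surjective f) (hg : Function.Surjective g) :
    IsLine (I ⊓ J) (LinearMap.eqLocus (f ∘ₗ LinearMap.fst A N M) (g ∘ₗ LinearMap.snd A N M)) := by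
  let P := LinearMap.eqLocus (f ∘ₗ LinearMap.fst A N M) (g ∘ₗ LinearMap.snd A N M)
  let r : P →ₗ[A] N := LinearMap.fst A N M ∘ₗ P.subtype
  let s : P →ₗ[A] M := LinearMap.snd A N M ∘ₗ P.subtype
  have hrs : ∀ p, f (r p) = g (s p) := fun p => p.2
  have hinj : ∀ p p', r p = r p' → s p = s p' → p = p' := fun p p' h1 h2 =>
    Subtype.ext (Prod.ext h1 h2)
  refine ⟨fun a ha x => hinj _ _ ?_ ?_, fun m hm hIJm => ?_⟩
  · rw [map_smul, hN.smul_eq_zero a ha.1, map_zero]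
  · rw [map_smul, hM.smul_eq_zero a ha.2, map_zero]
  -- A prime above `I ⊓ J` lies above `I` or `J`; the two cases are symmetric.
  · rcases hm.isPrime.inf_le.1 hIJm with h | h
    · exact exists_coordinate_of_fiberProduct hN hM hL rfl le_sup_left le_sup_right le_rfl hf hg r s
        hrs hinj (fun x y hxy => ⟨⟨(x, y), hxy⟩, rfl, rfl⟩) hm h
    · exact exists_coordinate_of_fiberProduct hM hN hL (inf_comm J I) le_sup_right le_sup_left
        (sup_comm I J).le hg hf s r (fun p => (hrs p).symm) (fun p p' h1 h2 => hinj p p' h2 h1)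
        (fun x y hxy => ⟨⟨(y, x), hxy.symm⟩, rfl, rfl⟩) hm h

/-- Repair one point of `F` at a time. Adding a multiple of `c ∈ K` is invisible in `T`, and if `c`
also lies in the points already treated, it does not disturb their fibres. -/
theorem IsLine.exists_modification (hM : IsLine J M) (hL : IsLine S L) (hT : IsLine K T)
    (hJS : J ≤ S) {t : L →ₗ[A] T} {h : M →ₗ[A] L} (F : Finset (Ideal A))
    (hF : ∀ m ∈ F, m.IsMaximal ∧ S ≤ m ∧ ¬ K ≤ m) :
    ∃ k : M →ₗ[A] L, t ∘ₗ k = t ∘ₗ h ∧ ∀ m ∈ F, ∃ y, k y ∉ m • (⊤ : Submodule A L) := by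
  classical
  induction F using Finset.induction_on with
  | empty => exact ⟨h, rfl, by simp⟩
  | insert m F hmF ih =>
    obtain ⟨k, hk, hkF⟩ := ih fun m hm => hF m (Finset.mem_insert_of_mem hm)
    obtain ⟨hm, hSm, hKm⟩ := hF m (Finset.mem_insert_self m F)
    by_cases hkm : ∃ y, k y ∉ m • (⊤ : Submodule A L)
    · refine ⟨k, hk, fun m' hm' => ?_⟩
      rcases Finset.mem_insert.1 hm' with rfl | hm'
      · exact hkm
      · exact hkF m' hm'
    push Not at hkm
    -- Prime avoidance in reverse: `m` contains neither `K` nor any of the other maximal ideals,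
    -- hence not their intersection.
    have hc : ¬ K ⊓ F.inf id ≤ m := by
      rw [hm.isPrime.inf_le, hm.isPrime.inf_le']
      rintro (h | ⟨m', hm', h⟩)
      · exact hKm h
      · obtain rfl : m' = m := (hF m' (Finset.mem_insert_of_mem hm')).1.eq_of_le hm.ne_top h
        exact hmF hm'
    obtain ⟨c, ⟨hcK, hcF⟩, hcm⟩ := SetLike.not_le_iff_exists.1 hc
    obtain ⟨β, y, b, hβ, hb, hby⟩ := hM.exists_coordinate m hm (hJS.trans hSm)
    obtain ⟨x, hx⟩ := hL.exists_notMem_smul_top hm hSm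
    let s : M →ₗ[A] L := quotientToSpan (fun a ha => hL.smul_eq_zero a (hJS ha)) x ∘ₗ β
    have hsy : s y = b • x := by
      rw [LinearMap.comp_apply, ← hby, quotientToSpan_mk]
    refine ⟨k + c • s, ?_, fun m' hm' => ?_⟩
    · rw [← hk]
      ext z
      simp only [LinearMap.comp_apply, LinearMap.add_apply, LinearMap.smul_apply, map_add,
        map_smul, hT.smul_eq_zero c hcK, add_zero]
    · rcases Finset.mem_insert.1 hm' with rfl | hm'
      · refine ⟨y, fun hy => hx (hm.mem_smul_top_of_smul_mem hb
          (hm.mem_smul_top_of_smul_mem hcm ?_))⟩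
        rw [← hsy]
        exact (Submodule.add_mem_iff_right _ (hkm y)).1 hy
      · obtain ⟨z, hz⟩ := hkF m' hm'
        refine ⟨z, fun hz' => hz ((Submodule.add_mem_iff_left _ ?_).1 hz')⟩
        exact Submodule.smul_mem_smul (Finset.inf_le (f := id) hm' hcF) Submodule.mem_top

/-- A map between lines which is surjective modulo `K` can be modified modulo `K` to a surjective
map if there are only finitely many maximal ideals outside `V(K)`. -/
theorem IsLine.exists_surjective (hM : IsLine J M) (hL : IsLine S L) (hT : IsLine K T)
    (hJS : J ≤ S) {t : L →ₗ[A] T} {h : M →ₗ[A] L}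
    (hth : Function.Surjective (t ∘ₗ h))
    (hfin : {m : Ideal A | m.IsMaximal ∧ S ≤ m ∧ ¬ K ≤ m}.Finite) :
    ∃ k : M →ₗ[A] L, t ∘ₗ k = t ∘ₗ h ∧ Function.Surjective k := by
  obtain ⟨k, hk, hkF⟩ := hM.exists_modification hL hT hJS (t := t) (h := h) hfin.toFinset
    fun m hm => hfin.mem_toFinset.1 hm
  refine ⟨k, hk, hL.surjective k fun m hm hSm => ?_⟩
  -- At points of `V(K)` the map is nonzero because its composite with `t` is; the finitely many
  -- others were arranged.
  by_cases hKm : K ≤ m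
  · obtain ⟨z, hz⟩ := hT.exists_notMem_smul_top hm hKm
    rw [← hk] at hth
    obtain ⟨y, rfl⟩ := hth z
    exact ⟨y, fun hy => hz (Submodule.map_mem_smul_top t hy)⟩
  · exact hkF m (hfin.mem_toFinset.2 ⟨hm, hSm, hKm⟩)

/-- Patching of lines along a quotient which differs from `A ⧸ (I ⊔ J)` at finitely many maximal
ideals only. -/
theorem IsLine.exists_patch {A : Type} [CommRing A] {I J K : Ideal A} {N M T : Type}
    [AddCommGroup N] [Module A N] [AddCommGroup M] [Module A M] [AddCommGroup T] [Module A T]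
    (hN : IsLine I N) (hM : IsLine J M) (hT : IsLine K T)
    (hIK : I ≤ K) (hJK : J ≤ K) {f : N →ₗ[A] T} {g : M →ₗ[A] T} (hf : Function.Surjective f)
    (hg : Function.Surjective g)
    (hfin : {m : Ideal A | m.IsMaximal ∧ I ⊔ J ≤ m ∧ ¬ K ≤ m}.Finite) :
    ∃ (P : Type) (_ : AddCommGroup P) (_ : Module A P) (r : P →ₗ[A] N) (s : P →ₗ[A] M),
      IsLine (I ⊓ J) P ∧ Function.Surjective r ∧ Function.Surjective s ∧
        ∀ p, f (r p) = g (s p) := by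
  -- Patching takes place over `L` rather than `T`, since `K` may be larger than `I ⊔ J`. The map
  -- `g` has to be replaced by a surjection `k` onto `L` lifting it.
  let L := N ⧸ (I ⊔ J) • (⊤ : Submodule A N)
  let π : N →ₗ[A] L := Submodule.mkQ _
  have hπ : Function.Surjective π := Submodule.mkQ_surjective _
  have hL : IsLine (I ⊔ J) L := hN.quotient le_sup_left
  let t : L →ₗ[A] T := Submodule.liftQ _ f <| by
    rw [hN.ker_eq hT hIK hf]
    exact Submodule.smul_mono (sup_le hIK hJK) le_rfl
  have ht : ∀ x, t (π x) = f x := fun _ => rfl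
  have htsurj : Function.Surjective t := fun z =>
    let ⟨x, hx⟩ := hf z
    ⟨π x, hx⟩
  obtain ⟨h, hh⟩ := hM.exists_lift (fun a ha => hL.smul_eq_zero a (le_sup_right (a := I) ha))
    htsurj g
  obtain ⟨k, hk, hksurj⟩ := hM.exists_surjective hL hT le_sup_right (t := t) (h := h)
    (by rw [hh]; exact hg) hfin
  let P := LinearMap.eqLocus (π ∘ₗ LinearMap.fst A N M) (k ∘ₗ LinearMap.snd A N M)
  refine ⟨P, inferInstance, inferInstance, LinearMap.fst A N M ∘ₗ P.subtype,
    LinearMap.snd A N M ∘ₗ P.subtype, hN.fiberProduct hM hL hπ hksurj, ?_, ?_, ?_⟩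
  · intro x
    obtain ⟨y, hy⟩ := hksurj (π x)
    exact ⟨⟨(x, y), hy.symm⟩, rfl⟩
  · intro y
    obtain ⟨x, hx⟩ := hπ (k y)
    exact ⟨⟨(x, y), hx⟩, rfl⟩
  · rintro ⟨⟨x, y⟩, hxy⟩
    have h1 : π x = k y := hxy
    change f x = g y
    rw [← ht, h1, ← hh, ← hk]
    rfl

end Line

/-! ### Lines and invertible modules -/

section Line

variable {R : Type*} [CommRing R] {L : Type*} [AddCommGroup L] [Module R L]

theorem Module.Invertible.exists_notMem [Module.Invertible R L] {m : Ideal R} (hm : m ≠ ⊤) :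
    ∃ (φ : Module.Dual R L) (x : L), φ x ∉ m := by
  by_contra! h
  have h1 : ∀ t : Module.Dual R L ⊗[R] L, contractLeft R L t ∈ m := by
    intro t
    induction t with
    | zero => simp
    | tmul φ x => exact h φ x
    | add s t hs ht => rw [map_add]; exact m.add_mem hs ht
  obtain ⟨t, ht⟩ := (Module.Invertible.bijective (R := R) (M := L)).2 1
  exact hm ((m.eq_top_iff_one).2 (ht ▸ h1 t))

/-- The swap of `L ⊗ L` is a scalar `u`, as `L ⊗ L` is invertible. Contracting with `φ` gives `u • φ
x • y = φ y • x`; for `x = y` this yields `(u - 1) * φ x * φ x = 0`, and since the values `φ x`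
avoid every maximal ideal, `u = 1`. -/
theorem Module.Invertible.smul_comm_dual [Module.Invertible R L] (φ : Module.Dual R L) (x y : L) :
    φ x • y = φ y • x := by
  obtain ⟨u, hu⟩ := (Module.Invertible.toModuleEnd_bijective R (L ⊗[R] L)).2
    (TensorProduct.comm R L L).toLinearMap
  have hu' : ∀ x y : L, u • (x ⊗ₜ[R] y) = y ⊗ₜ[R] x := fun x y =>
    LinearMap.congr_fun hu (x ⊗ₜ y)
  have key : ∀ (φ : Module.Dual R L) (x y : L), u • (φ x • y) = φ y • x := by
    intro φ x y
    have h := congrArg ((TensorProduct.lid R L).toLinearMap ∘ₗ φ.rTensor L) (hu' x y)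
    simpa using h
  have hsq : ∀ (φ : Module.Dual R L) (x : L), (u - 1) * φ x * φ x = 0 := by
    intro φ x
    have h := congrArg φ (key φ x x)
    simp only [map_smul, smul_eq_mul] at h
    linear_combination h
  have hone : u - 1 = 0 := by
    have h1 : (⊥ : Ideal R).colon {u - 1} = ⊤ := by
      refine Ideal.eq_top_of_forall_isMaximal (I := ⊥) bot_le fun m hm _ => ?_
      obtain ⟨φ, x, hx⟩ := Module.Invertible.exists_notMem (L := L) hm.ne_top
      refine ⟨φ x * φ x, ?_, fun h => hx ((hm.isPrime.mem_or_mem h).elim id id)⟩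
      rw [Submodule.mem_colon_singleton, smul_eq_mul, Submodule.mem_bot]
      linear_combination hsq φ x
    have h2 : (1 : R) ∈ (⊥ : Ideal R).colon {u - 1} := h1 ▸ Submodule.mem_top
    rw [Submodule.mem_colon_singleton] at h2
    simpa using h2
  rw [← key φ x y, sub_eq_zero.1 hone, one_smul]

theorem Module.Invertible.of_exists_notMem
    (h : ∀ m : Ideal R, m.IsMaximal → ∃ (φ : Module.Dual R L) (x : L), φ x ∉ m ∧
      ∀ y z, φ y • z = φ z • y) : Module.Invertible R L where
  bijective := by
    constructor
    · intro s t hst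
      rw [← sub_eq_zero]
      have h1 : LinearMap.ker (LinearMap.toSpanSingleton R _ (s - t)) = ⊤ := by
        refine Ideal.eq_top_of_forall_isMaximal (I := ⊥) bot_le fun m hm _ => ?_
        obtain ⟨φ, x, hx, hφ⟩ := h m hm
        refine ⟨φ x, ?_, hx⟩
        -- Up to the factor `φ x`, every tensor is a multiple of `φ ⊗ x`, with its contraction as
        -- coefficient; so contraction is injective where `φ x` is invertible.
        have key : ∀ t : Module.Dual R L ⊗[R] L, φ x • t = contractLeft R L t • (φ ⊗ₜ[R] x) := by
          intro t
          induction t with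
          | zero => simp
          | tmul ψ y =>
            have h2 : φ y • ψ = ψ y • φ := by
              ext z
              have h3 := congrArg ψ (hφ y z)
              simp only [map_smul, smul_eq_mul] at h3
              simp only [LinearMap.smul_apply, smul_eq_mul, h3, mul_comm]
            rw [contractLeft_apply, ← TensorProduct.tmul_smul, hφ x y, TensorProduct.tmul_smul,
              TensorProduct.smul_tmul', h2, TensorProduct.smul_tmul']
          | add s t hs ht => rw [smul_add, hs, ht, map_add, add_smul]
        rw [LinearMap.mem_ker, LinearMap.toSpanSingleton_apply, smul_sub, key, key, hst, sub_self]
      have h2 : (1 : R) ∈ LinearMap.ker (LinearMap.toSpanSingleton R _ (s - t)) :=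
        h1 ▸ Submodule.mem_top
      simpa using h2
    · have h1 : LinearMap.range (contractLeft R L) = ⊤ := by
        refine Ideal.eq_top_of_forall_isMaximal (I := ⊥) bot_le fun m hm _ => ?_
        obtain ⟨φ, x, hx, -⟩ := h m hm
        exact ⟨φ x, ⟨φ ⊗ₜ x, contractLeft_apply φ x⟩, hx⟩
      exact LinearMap.range_eq_top.1 h1

variable {A : Type*} [CommRing A] {I : Ideal A} [Module A L] [Module (A ⧸ I) L]
  [IsScalarTower A (A ⧸ I) L]

theorem quotient_mk_smul (a : A) (x : L) : Ideal.Quotient.mk I a • x = a • x :=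
  algebraMap_smul (A ⧸ I) a x

theorem IsLine.of_invertible [Module.Invertible (A ⧸ I) L] : IsLine I L where
  smul_eq_zero a ha x := by
    rw [← quotient_mk_smul (I := I), Ideal.Quotient.eq_zero_iff_mem.2 ha, zero_smul]
  exists_coordinate m hm hIm := by
    have h1 : m.map (Ideal.Quotient.mk I) ≠ ⊤ := by
      intro h
      have h2 := congrArg (Ideal.comap (Ideal.Quotient.mk I)) h
      rw [Ideal.comap_map_of_surjective _ Ideal.Quotient.mk_surjective, Ideal.comap_top,
        ← RingHom.ker_eq_comap_bot, Ideal.mk_ker, sup_eq_left.2 hIm] at h2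
      exact hm.ne_top h2
    obtain ⟨φ, x, hx⟩ := Module.Invertible.exists_notMem (L := L) h1
    obtain ⟨a, ha⟩ := Ideal.Quotient.mk_surjective (φ x)
    refine ⟨φ.restrictScalars A, x, a, fun y z b c hb hc => ?_, fun h => hx ?_, ha⟩
    · rw [← quotient_mk_smul (I := I) b, ← quotient_mk_smul (I := I) c, hb, hc]
      exact Module.Invertible.smul_comm_dual φ y z
    · rw [← ha]
      exact Ideal.mem_map_of_mem _ h

theorem IsLine.invertible (hL : IsLine I L) : Module.Invertible (A ⧸ I) L := by
  refine Module.Invertible.of_exists_notMem fun m hm => ?_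
  obtain ⟨φ, x, a, hφ, ha, hax⟩ := hL.exists_coordinate (m.comap (Ideal.Quotient.mk I))
    (Ideal.comap_isMaximal_of_surjective _ Ideal.Quotient.mk_surjective)
    (fun a ha => by
      rw [Ideal.mem_comap, Ideal.Quotient.eq_zero_iff_mem.2 ha]
      exact m.zero_mem)
  refine ⟨φ.extendScalarsOfSurjective Ideal.Quotient.mk_surjective, x, ?_, fun y z => ?_⟩
  · change φ x ∉ m
    rw [← hax]
    exact ha
  · obtain ⟨b, hb⟩ := Ideal.Quotient.mk_surjective (φ y)
    obtain ⟨c, hc⟩ := Ideal.Quotient.mk_surjective (φ z)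
    change φ y • z = φ z • y
    rw [← hb, ← hc, quotient_mk_smul, quotient_mk_smul]
    exact hφ y z b c hb hc

end Line

/-! ### Arithmetic of Weil numbers -/

section Weil

variable {q : ℕ}

theorem WeilNumber.isIntegral_gen (a : WeilNumber q) : IsIntegral ℤ a.gen := by
  have h := a.2.1
  rw [← IntermediateField.AdjoinSimple.algebraMap_gen ℚ a.1] at h
  exact (isIntegral_algebraMap_iff (algebraMap a.field ℂ).injective).1 h

/-- Since `|π|² = q`, the number `q / π` is the complex conjugate of `π`. This makes the order `ℤ[π,
q / π]` finite over `ℤ`. -/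
theorem WeilNumber.isIntegral_div_gen (a : WeilNumber q) : IsIntegral ℤ ((q : a.field) / a.gen) := by
  by_cases h0 : a.gen = 0
  · rw [h0, div_zero]
    exact isIntegral_zero
  refine (isIntegral_algebraMap_iff (algebraMap a.field ℂ).injective).1 ?_
  have hgen : algebraMap a.field ℂ a.gen = a.1 := IntermediateField.AdjoinSimple.algebraMap_gen ℚ a.1
  have h1 : ‖a.1‖ = Real.sqrt q := by
    rw [← hgen]
    exact a.2.2 (algebraMap a.field ℂ)
  have hne : a.1 ≠ 0 := by
    rw [← hgen]
    simpa using h0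
  have h2 : algebraMap a.field ℂ ((q : a.field) / a.gen) = (starRingEnd ℂ) a.1 := by
    rw [map_div₀, hgen, map_natCast, div_eq_iff hne, mul_comm, Complex.mul_conj,
      Complex.normSq_eq_norm_sq, h1, Real.sq_sqrt (Nat.cast_nonneg q)]
    simp
  rw [h2]
  exact a.2.1.map (starRingEnd ℂ).toIntAlgHom

theorem FrobVer.isIntegral_eval (a : WeilNumber q) (x : FrobVer q) :
    IsIntegral ℤ (FrobVer.eval a x) := by
  obtain ⟨x, rfl⟩ := Ideal.Quotient.mk_surjective x
  induction x using MvPolynomial.induction_on with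
  | C n =>
    have : FrobVer.eval a (Ideal.Quotient.mk _ (MvPolynomial.C n)) = algebraMap ℤ a.field n := by
      simp [FrobVer.eval]
    rw [this]
    exact isIntegral_algebraMap
  | add x y hx hy => rw [map_add, map_add]; exact hx.add hy
  | mul_X x i hx =>
    rw [map_mul, map_mul]
    refine hx.mul ?_
    fin_cases i
    · change IsIntegral ℤ (FrobVer.eval a (Ideal.Quotient.mk _ (MvPolynomial.X 0)))
      rw [FrobVer.eval_frob]
      exact a.isIntegral_gen
    · change IsIntegral ℤ (FrobVer.eval a (Ideal.Quotient.mk _ (MvPolynomial.X 1)))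
      rw [FrobVer.eval_ver]
      exact a.isIntegral_div_gen

/-- The order `ℤ[π, q / π]`. -/
abbrev FrobVer.order (a : WeilNumber q) : Type := FrobVer q ⧸ RingHom.ker (FrobVer.eval a)

instance FrobVer.isPrime_ker_eval (a : WeilNumber q) : (RingHom.ker (FrobVer.eval a)).IsPrime :=
  RingHom.ker_isPrime _

instance FrobVer.isIntegral_order (a : WeilNumber q) : Algebra.IsIntegral ℤ (FrobVer.order a) where
  isIntegral x := by
    obtain ⟨x, rfl⟩ := Ideal.Quotient.mk_surjective x
    let f : FrobVer.order a →ₐ[ℤ] a.field := (RingHom.kerLift (FrobVer.eval a)).toIntAlgHom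
    have hf : Function.Injective f := RingHom.kerLift_injective _
    exact (isIntegral_algHom_iff f hf).1 (FrobVer.isIntegral_eval a x)

instance FrobVer.finite_order (a : WeilNumber q) : Module.Finite ℤ (FrobVer.order a) := by
  let g : MvPolynomial (Fin 2) ℤ →+* FrobVer.order a :=
    (Ideal.Quotient.mk (RingHom.ker (FrobVer.eval a))).comp (Ideal.Quotient.mk _)
  have hg : ∀ n : ℤ, g (algebraMap ℤ _ n) = algebraMap ℤ (FrobVer.order a) n := fun n => by
    rw [eq_intCast (algebraMap ℤ (FrobVer.order a)), ← map_intCast g]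
    simp
  let f : MvPolynomial (Fin 2) ℤ →ₐ[ℤ] FrobVer.order a := { g with commutes' := hg }
  have h1 : Algebra.FiniteType ℤ (FrobVer.order a) :=
    Algebra.FiniteType.of_surjective f
      (Ideal.Quotient.mk_surjective.comp Ideal.Quotient.mk_surjective)
  have h2 := Algebra.IsIntegral.finite (R := ℤ) (A := FrobVer.order a)
  exact h2

/-- Polynomials in `F` inside the kernel detect the minimal polynomial. An inclusion of kernels
makes `a` a root of the irreducible minimal polynomial of `b`, so distinct classes have incomparable
kernels. -/
theorem FrobVer.equiv_of_ker_le {a b : WeilNumber q}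
    (h : RingHom.ker (FrobVer.eval b) ≤ RingHom.ker (FrobVer.eval a)) : b ≈ a := by
  have hb : IsIntegral ℚ b.1 := b.2.1.tower_top
  have ha : IsIntegral ℚ a.1 := a.2.1.tower_top
  have key : ∀ (c : WeilNumber q) (P : Polynomial ℤ), FrobVer.eval c
      (Polynomial.aeval (Ideal.Quotient.mk _ (MvPolynomial.X 0) : FrobVer q) P) = 0 ↔
        Polynomial.aeval c.1 P = 0 := by
    intro c P
    have h1 : FrobVer.eval c (Polynomial.aeval (Ideal.Quotient.mk _ (MvPolynomial.X 0)) P) =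
        Polynomial.aeval c.gen P := by
      have h2 := Polynomial.aeval_algHom_apply (FrobVer.eval c).toIntAlgHom
        (Ideal.Quotient.mk _ (MvPolynomial.X 0)) P
      change _ = FrobVer.eval c _ at h2
      exact h2.symm.trans (congrArg (fun z => Polynomial.aeval z P) (FrobVer.eval_frob c))
    rw [h1, ← map_eq_zero_iff (algebraMap c.field ℂ) (algebraMap c.field ℂ).injective,
      ← Polynomial.aeval_algebraMap_apply]
    exact iff_of_eq (congrArg (fun z => Polynomial.aeval z P = 0)
      (IntermediateField.AdjoinSimple.algebraMap_gen ℚ c.1))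
  have hroot : Polynomial.aeval a.1 (minpoly ℤ b.1) = 0 :=
    (key a _).1 (h ((key b _).2 (minpoly.aeval ℤ b.1)))
  have hmin : minpoly ℚ b.1 = minpoly ℚ a.1 := by
    refine minpoly.eq_of_irreducible_of_monic (minpoly.irreducible hb) ?_ (minpoly.monic hb)
    rw [minpoly.isIntegrallyClosed_eq_field_fractions' ℚ b.2.1, Polynomial.aeval_map_algebraMap,
      hroot]
  refine ⟨(((IntermediateField.adjoinRootEquivAdjoin ℚ hb).symm.trans
      (AdjoinRoot.algEquivOfEq ℚ _ _ hmin)).trans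
      (IntermediateField.adjoinRootEquivAdjoin ℚ ha)).toRingEquiv, ?_⟩
  change IntermediateField.adjoinRootEquivAdjoin ℚ ha (AdjoinRoot.algEquivOfEq ℚ _ _ hmin
      ((IntermediateField.adjoinRootEquivAdjoin ℚ hb).symm _)) = _
  rw [IntermediateField.adjoinRootEquivAdjoin_symm_apply_gen, AdjoinRoot.algEquivOfEq_root,
      IntermediateField.adjoinRootEquivAdjoin_apply_root]

/-- A nonzero element of `J / P` is integral over `ℤ`, and `A ⧸ P` is a domain, so `J` contains a
nonzero integer; a finitely generated torsion group is finite. -/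
theorem Ideal.finite_quotient_of_lt {A : Type*} [CommRing A] {P J : Ideal A} [P.IsPrime]
    [Module.Finite ℤ (A ⧸ P)] (h : P < J) : Finite (A ⧸ J) := by
  obtain ⟨y, hyJ, hyP⟩ := SetLike.exists_of_lt h
  have hy : Ideal.Quotient.mk P y ≠ 0 := by
    rwa [Ne, Ideal.Quotient.eq_zero_iff_mem]
  have h1 : (J.map (Ideal.Quotient.mk P)).comap (algebraMap ℤ (A ⧸ P)) ≠ ⊥ :=
    Ideal.comap_ne_bot_of_integral_mem hy (Ideal.mem_map_of_mem _ hyJ)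
      (Algebra.IsIntegral.isIntegral _)
  obtain ⟨n, hn, hn0⟩ := Submodule.exists_mem_ne_zero_of_ne_bot h1
  have hn' : ((n : A ⧸ J)) = 0 := by
    have h2 : (n : A) ∈ (J.map (Ideal.Quotient.mk P)).comap (Ideal.Quotient.mk P) := by
      rw [Ideal.mem_comap, eq_intCast] at hn
      rwa [Ideal.mem_comap, map_intCast]
    rw [Ideal.comap_map_of_surjective _ Ideal.Quotient.mk_surjective,
      ← RingHom.ker_eq_comap_bot, Ideal.mk_ker, sup_eq_left.2 h.le] at h2
    have h3 := Ideal.Quotient.eq_zero_iff_mem.2 h2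
    rwa [map_intCast] at h3
  have hfin : Module.Finite ℤ (A ⧸ J) :=
    Module.Finite.of_surjective (Ideal.Quotient.factor h.le).toAddMonoidHom.toIntLinearMap
      (Ideal.Quotient.factor_surjective h.le)
  exact Module.finite_of_fg_torsion _ fun {x} =>
    ⟨⟨n, mem_nonZeroDivisors_of_ne_zero hn0⟩, by
      change n • x = 0
      rw [zsmul_eq_mul, hn', zero_mul]⟩

theorem Ideal.finite_setOf_le {A : Type*} [CommRing A] (J : Ideal A) [Finite (A ⧸ J)] :
    {m : Ideal A | J ≤ m}.Finite := by
  have : Finite (Ideal (A ⧸ J)) := Finite.of_injective (fun I => (I : Set (A ⧸ J)))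
    SetLike.coe_injective
  refine (Set.finite_range fun I : Ideal (A ⧸ J) => I.comap (Ideal.Quotient.mk J)).subset ?_
  intro m hm
  refine ⟨m.map (Ideal.Quotient.mk J), ?_⟩
  change Ideal.comap _ _ = m
  rw [Ideal.comap_map_of_surjective _ Ideal.Quotient.mk_surjective, ← RingHom.ker_eq_comap_bot,
    Ideal.mk_ker, sup_eq_left.2 hm]

theorem FrobVer.ker_toProd_eq_inf (w : Finset (WeilClass q)) :
    RingHom.ker (FrobVer.toProd w) = w.inf fun c => RingHom.ker (FrobVer.eval c.rep) := by
  ext x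
  rw [FrobVer.mem_ker_toProd, Submodule.mem_finsetInf]
  rfl

theorem FrobVer.ker_toProd_anti {v w : Finset (WeilClass q)} (h : v ⊆ w) :
    RingHom.ker (FrobVer.toProd w) ≤ RingHom.ker (FrobVer.toProd v) := fun _ hx =>
  FrobVer.mem_ker_toProd.2 fun c hc => FrobVer.mem_ker_toProd.1 hx c (h hc)

/-- `Spec R_v ∩ Spec R_w` and `Spec R_{v ∩ w}` differ at finitely many closed points only. -/
theorem FrobVer.finite_isMaximal {u v w : Finset (WeilClass q)}
    (h : ∀ c ∈ v, c ∈ w → c ∈ u) :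
    {m : Ideal (FrobVer q) | m.IsMaximal ∧
      RingHom.ker (FrobVer.toProd v) ⊔ RingHom.ker (FrobVer.toProd w) ≤ m ∧
      ¬ RingHom.ker (FrobVer.toProd u) ≤ m}.Finite := by
  have h1 : (⋃ a ∈ v, ⋃ b ∈ w, {m : Ideal (FrobVer q) | a ≠ b ∧
      RingHom.ker (FrobVer.eval a.rep) ⊔ RingHom.ker (FrobVer.eval b.rep) ≤ m}).Finite := by
    refine v.finite_toSet.biUnion fun a _ => w.finite_toSet.biUnion fun b _ => ?_
    by_cases hab : a = b
    · simp [hab]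
    have hab' : ¬ b.rep ≈ a.rep := fun h => hab <| by
      rw [← WeilClass.mk_rep a, ← WeilClass.mk_rep b]
      exact (Quotient.sound h).symm
    have hlt : RingHom.ker (FrobVer.eval a.rep) <
        RingHom.ker (FrobVer.eval a.rep) ⊔ RingHom.ker (FrobVer.eval b.rep) :=
      left_lt_sup.2 (mt FrobVer.equiv_of_ker_le hab')
    have := Ideal.finite_quotient_of_lt hlt
    exact (Ideal.finite_setOf_le (RingHom.ker (FrobVer.eval a.rep) ⊔
      RingHom.ker (FrobVer.eval b.rep))).subset fun m hm => hm.2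
  refine h1.subset ?_
  rintro m ⟨hm, hvw, hu⟩
  -- By primality `m` contains the kernels of some `a ∈ v` and `b ∈ w`. If `a = b`, this class lies
  -- in `u`, contrary to the choice of `m`.
  rw [sup_le_iff, FrobVer.ker_toProd_eq_inf, FrobVer.ker_toProd_eq_inf, hm.isPrime.inf_le',
    hm.isPrime.inf_le'] at hvw
  obtain ⟨⟨a, ha, ham⟩, b, hb, hbm⟩ := hvw
  simp only [Set.mem_iUnion]
  refine ⟨a, ha, b, hb, ?_, sup_le ham hbm⟩
  rintro rfl
  refine hu (le_trans ?_ ham)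
  rw [FrobVer.ker_toProd_eq_inf]
  exact Finset.inf_le (h a ha hb)

instance WeilClass.countable : Countable (WeilClass q) := by
  have h1 : {x : ℂ | IsAlgebraic ℚ x}.Countable := Algebraic.countable ℚ ℂ
  have h2 : Countable (WeilNumber q) :=
    (h1.mono fun x (hx : IsWeilNumber q x) => hx.1.tower_top.isAlgebraic).to_subtype
  exact inferInstanceAs (Countable (Quotient _))

end Weil

/-! ### Projective systems of lines -/

section Tower

theorem exists_thread {X : ℕ → Type*} (r : ∀ n, X (n + 1) → X n)
    (hr : ∀ n, Function.Surjective (r n)) (n : ℕ) (y : X n) :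
    ∃ x : ∀ n, X n, (∀ n, r n (x (n + 1)) = x n) ∧ x n = y := by
  induction n generalizing X with
  | zero =>
    choose g hg using hr
    exact ⟨fun n => Nat.rec y (fun n z => g n z) n, fun n => hg n _, rfl⟩
  | succ n ih =>
    -- Solve the problem in the shifted tower; the coordinate at `0` is then forced.
    obtain ⟨x, hx, hxy⟩ := ih (X := fun n => X (n + 1)) (fun n => r (n + 1)) (fun n => hr (n + 1)) y
    refine ⟨fun n => Nat.casesOn n (r 0 (x 0)) x, fun n => ?_, hxy⟩
    cases n with
    | zero => rfl
    | succ n => exact hx n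

theorem exists_limit {A : Type*} [CommRing A] {X : ℕ → Type} [∀ n, AddCommGroup (X n)]
    [∀ n, Module A (X n)] (r : ∀ n, X (n + 1) →ₗ[A] X n) (hr : ∀ n, Function.Surjective (r n)) :
    ∃ (Y : Type) (_ : AddCommGroup Y) (_ : Module A Y) (π : ∀ n, Y →ₗ[A] X n),
      ∀ n, Function.Surjective (π n) ∧ ∀ y, r n (π (n + 1) y) = π n y := by
  let Y : Submodule A (∀ n, X n) :=
    { carrier := {x | ∀ n, r n (x (n + 1)) = x n}
      add_mem' := fun {x y} hx hy n => by
        rw [Pi.add_apply, Pi.add_apply, map_add, hx n, hy n]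
      zero_mem' := fun n => map_zero (r n)
      smul_mem' := fun a x hx n => by
        rw [Pi.smul_apply, Pi.smul_apply, map_smul, hx n] }
  refine ⟨Y, inferInstance, inferInstance, fun n => LinearMap.proj n ∘ₗ Y.subtype, fun n =>
    ⟨fun y => ?_, fun y => y.2 n⟩⟩
  obtain ⟨x, hx, hxy⟩ := exists_thread (fun n => r n) hr n y
  exact ⟨⟨x, hx⟩, hxy⟩

variable {A : Type*} [CommRing A] {I J K : Ideal A} {L N : Type*} [AddCommGroup L] [Module A L]
  [AddCommGroup N] [Module A N]

/-- Both sides describe the kernel of the surjection of lines `N → L ⧸ K • ⊤`. -/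
theorem IsLine.mem_smul_top_iff (hN : IsLine I N) (hL : IsLine J L) (hIJ : I ≤ J) (hJK : J ≤ K)
    {f : N →ₗ[A] L} (hf : Function.Surjective f) (x : N) :
    f x ∈ K • (⊤ : Submodule A L) ↔ x ∈ K • (⊤ : Submodule A N) := by
  have h := hN.ker_eq (hL.quotient hJK) (hIJ.trans hJK)
    (f := Submodule.mkQ _ ∘ₗ f) ((Submodule.mkQ_surjective _).comp hf)
  rw [← h, LinearMap.mem_ker, LinearMap.comp_apply, Submodule.mkQ_apply,
    Submodule.Quotient.mk_eq_zero]

end Tower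

/-! ### Extension from `V` to all of `W_q` -/

section Weil

variable {q : ℕ} {V W : Set (WeilClass q)}

/-- The kernel of `ℤ[F, V] / (F V - q) → R_w`. -/
abbrev FrobVer.ideal (w : Finset (WeilClass q)) : Ideal (FrobVer q) :=
  RingHom.ker (FrobVer.toProd w)

theorem FrobVer.ideal_inf {v w u : Finset (WeilClass q)} (h : ∀ c, c ∈ u ↔ c ∈ v ∨ c ∈ w) :
    FrobVer.ideal v ⊓ FrobVer.ideal w = FrobVer.ideal u := by
  ext x
  rw [Submodule.mem_inf, FrobVer.mem_ker_toProd, FrobVer.mem_ker_toProd, FrobVer.mem_ker_toProd]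
  exact ⟨fun hx c hc => ((h c).1 hc).elim (hx.1 c) (hx.2 c),
    fun hx => ⟨fun c hc => hx c ((h c).2 (Or.inl hc)), fun c hc => hx c ((h c).2 (Or.inr hc))⟩⟩

theorem FrobVer.ideal_empty : FrobVer.ideal (∅ : Finset (WeilClass q)) = ⊤ := by
  rw [FrobVer.ideal, FrobVer.ker_toProd_eq_inf, Finset.inf_empty]

/-- The projection `ℤ[F, V] / (F V - q) → R_w`. -/
def MinCentralOrder.mk (w : Finset (WeilClass q)) : FrobVer q →+* MinCentralOrder w :=
  Ideal.Quotient.mk (FrobVer.ideal w)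

theorem MinCentralOrder.mk_surjective (w : Finset (WeilClass q)) :
    Function.Surjective (MinCentralOrder.mk w) := Ideal.Quotient.mk_surjective

instance ProModule.moduleFrobVer (M : ProModule V) (v : FinSub V) : Module (FrobVer q) (M.obj v) :=
  Module.compHom (M.obj v) (MinCentralOrder.mk v.1)

/-- The transition map as a linear map over `ℤ[F, V] / (F V - q)`. -/
def ProModule.linearMap (M : ProModule V) {v w : FinSub V} (h : v.1 ⊆ w.1) :
    M.obj w →ₗ[FrobVer q] M.obj v where
  toFun := M.map h
  map_add' := map_add _
  map_smul' a x := (M.map h).map_smulₛₗ (MinCentralOrder.mk w.1 a) x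

theorem ProModule.linearMap_linearMap (M : ProModule V) {u v w : FinSub V} (huv : u.1 ⊆ v.1)
    (hvw : v.1 ⊆ w.1) (x : M.obj w) :
    M.linearMap huv (M.linearMap hvw x) = M.linearMap (huv.trans hvw) x :=
  M.map_map huv hvw x

theorem ProModule.IsInvertible.isLine {M : ProModule V} (hM : M.IsInvertible) (v : FinSub V) :
    IsLine (FrobVer.ideal v.1) (M.obj v) := by
  let _ : Module (FrobVer q ⧸ FrobVer.ideal v.1) (M.obj v) := M.module v
  have : IsScalarTower (FrobVer q) (FrobVer q ⧸ FrobVer.ideal v.1) (M.obj v) :=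
    ⟨fun a b x => by
      obtain ⟨b, rfl⟩ := Ideal.Quotient.mk_surjective b
      exact mul_smul (MinCentralOrder.mk v.1 a) (MinCentralOrder.mk v.1 b) x⟩
  have : Module.Invertible (FrobVer q ⧸ FrobVer.ideal v.1) (M.obj v) := hM.invertible v
  exact IsLine.of_invertible

open Classical in
/-- The intersection of a finite set with `V`. -/
def FinSub.inter (w : Finset (WeilClass q)) (V : Set (WeilClass q)) : FinSub V :=
  ⟨w.filter (· ∈ V), fun _ hc => (Finset.mem_filter.1 hc).2⟩

theorem FinSub.mem_inter {w : Finset (WeilClass q)} {c : WeilClass q} :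
    c ∈ (FinSub.inter w V).1 ↔ c ∈ w ∧ c ∈ V := by
  classical
  exact Finset.mem_filter

theorem FinSub.inter_mono {v w : Finset (WeilClass q)} (h : v ⊆ w) :
    (FinSub.inter v V).1 ⊆ (FinSub.inter w V).1 := fun _ hc =>
  FinSub.mem_inter.2 ⟨h (FinSub.mem_inter.1 hc).1, (FinSub.mem_inter.1 hc).2⟩

/-- An extension of `M_{w ∩ V}` to an invertible `R_w`-module. -/
structure ProModule.Extension (M : ProModule V) (w : Finset (WeilClass q)) where
  /-- The underlying module. -/
  obj : Type
  [addCommGroup : AddCommGroup obj]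
  [module : Module (FrobVer q) obj]
  isLine : IsLine (FrobVer.ideal w) obj
  /-- The map to `M_{w ∩ V}`. -/
  toObj : obj →ₗ[FrobVer q] M.obj (FinSub.inter w V)
  surjective : Function.Surjective toObj

attribute [instance] ProModule.Extension.addCommGroup ProModule.Extension.module

namespace ProModule.IsInvertible

variable {M : ProModule V} (hM : M.IsInvertible)

include hM in
theorem nonempty_extension_empty : Nonempty (M.Extension ∅) := by
  refine ⟨⟨M.obj (FinSub.inter ∅ V), ?_, LinearMap.id, Function.surjective_id⟩⟩
  have h : (FinSub.inter ∅ V : FinSub V).1 = ∅ := Finset.eq_empty_of_forall_notMem fun c hc =>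
    Finset.notMem_empty c (FinSub.mem_inter.1 hc).1
  have := hM.isLine (FinSub.inter ∅ V)
  rwa [h] at this

include hM in
theorem exists_extension {v w : Finset (WeilClass q)} (h : v ⊆ w) (N : M.Extension v) :
    ∃ (N' : M.Extension w) (r : N'.obj →ₗ[FrobVer q] N.obj), Function.Surjective r ∧
      ∀ x, N.toObj (r x) = M.linearMap (FinSub.inter_mono h) (N'.toObj x) := by
  classical
  have hmono := FinSub.inter_mono (V := V) h
  -- Glue `N` and `M_{w ∩ V}` along `M_{v ∩ V}`; the result is a line for `v ∪ (w ∩ V)`.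
  obtain ⟨P, _, _, r, s, hP, hr, hs, hrs⟩ := N.isLine.exists_patch
    (hM.isLine (FinSub.inter w V)) (hM.isLine (FinSub.inter v V))
    (FrobVer.ker_toProd_anti fun _ hc => (FinSub.mem_inter.1 hc).1)
    (FrobVer.ker_toProd_anti hmono) N.surjective (g := M.linearMap hmono) (hM.surjective hmono)
    (FrobVer.finite_isMaximal fun _ hcv hcw =>
      FinSub.mem_inter.2 ⟨hcv, (FinSub.mem_inter.1 hcw).2⟩)
  let u := v ∪ (FinSub.inter w V).1
  rw [FrobVer.ideal_inf (u := u) fun c => Finset.mem_union] at hP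
  -- The remaining classes `w \ u` carry no prescribed module, so a free line is glued on with `K =
  -- ⊤` and `T = 0`: there is nothing to match, and `u` and `w \ u` meet at finitely many points.
  obtain ⟨Q, _, _, r', s', hQ, hr', -, -⟩ := hP.exists_patch
    (isLine_quotient (FrobVer.ideal (w \ u))) (isLine_top (L := PUnit)) le_top le_top
    (f := 0) (g := 0) (fun _ => ⟨0, rfl⟩) (fun _ => ⟨0, rfl⟩) (by
      rw [← FrobVer.ideal_empty]
      exact FrobVer.finite_isMaximal fun _ hcu hcw => absurd hcu (Finset.mem_sdiff.1 hcw).2)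
  rw [FrobVer.ideal_inf (u := w) fun c => by
    rw [← Finset.mem_union, Finset.union_sdiff_of_subset]
    exact Finset.union_subset h fun _ hc => (FinSub.mem_inter.1 hc).1] at hQ
  exact ⟨⟨Q, hQ, s ∘ₗ r', hs.comp hr'⟩, r ∘ₗ r', hr.comp hr', fun x => hrs (r' x)⟩

include hM in
theorem exists_tower {w : ℕ → Finset (WeilClass q)} (hw : Monotone w) :
    ∃ (N : ∀ n, M.Extension (w n)) (r : ∀ n, (N (n + 1)).obj →ₗ[FrobVer q] (N n).obj),
      ∀ n, Function.Surjective (r n) ∧ ∀ x, (N n).toObj (r n x) =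
        M.linearMap (FinSub.inter_mono (hw n.le_succ)) ((N (n + 1)).toObj x) := by
  obtain ⟨N⟩ := hM.nonempty_extension_empty
  obtain ⟨N₀, -, -⟩ := hM.exists_extension (Finset.empty_subset (w 0)) N
  choose next r hr using fun n : ℕ => hM.exists_extension (hw n.le_succ)
  exact ⟨fun n => Nat.rec N₀ next n, fun n => r n _, fun n => hr n _⟩

end ProModule.IsInvertible

theorem WeilClass.exists_exhaustion : ∃ w : ℕ → Finset (WeilClass q),
    Monotone w ∧ ∀ v : Finset (WeilClass q), ∃ n, v ⊆ w n := by
  obtain ⟨f, hf⟩ := Countable.exists_injective_nat (WeilClass q)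
  have hfin : ∀ n, {c : WeilClass q | f c < n}.Finite := fun n =>
    (Set.finite_lt_nat n).preimage hf.injOn
  refine ⟨fun n => (hfin n).toFinset, fun m n hmn => ?_, fun v => ⟨v.sup f + 1, fun c hc => ?_⟩⟩
  · exact Set.Finite.toFinset_subset_toFinset.2 fun c hc => lt_of_lt_of_le hc hmn
  · rw [Set.Finite.mem_toFinset]
    exact Nat.lt_succ_of_le (Finset.le_sup hc)

/-- Realising all levels as quotients of a single module `X` makes the transition maps and their
compatibility automatic. -/
theorem ProModule.IsInvertible.exists_limit {M : ProModule V} (hM : M.IsInvertible) :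
    ∃ (X : Type) (_ : AddCommGroup X) (_ : Module (FrobVer q) X)
      (κ : Finset (WeilClass q) → Submodule (FrobVer q) X) (ψ : ∀ v : FinSub V, X →ₗ[FrobVer q] M.obj v),
      (∀ w, IsLine (FrobVer.ideal w) (X ⧸ κ w)) ∧ (∀ v w, v ⊆ w → κ w ≤ κ v) ∧
      (∀ v, Function.Surjective (ψ v)) ∧ (∀ v : FinSub V, LinearMap.ker (ψ v) = κ v.1) ∧
      ∀ (v w : FinSub V) (h : v.1 ⊆ w.1) (x : X), M.map h (ψ w x) = ψ v x := by
  obtain ⟨w, hw, hex⟩ := WeilClass.exists_exhaustion (q := q)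
  choose i hi using hex
  obtain ⟨N, r, hr⟩ := hM.exists_tower hw
  obtain ⟨X, _, _, π, hπ⟩ := _root_.exists_limit (X := fun n => (N n).obj) r fun n => (hr n).1
  have hi' : ∀ v : FinSub V, ∀ n, i v.1 ≤ n → v.1 ⊆ (FinSub.inter (w n) V).1 := fun v n hn c hc =>
    FinSub.mem_inter.2 ⟨hw hn (hi v.1 hc), v.2 hc⟩
  -- The quotient by `κ v` is the reduction to `R_v` of the stage `i v`, where `v ⊆ w (i v)`. By
  -- `hκ` any later stage gives the same submodule, so different `v` can be compared at a common
  -- stage.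
  let κ : Finset (WeilClass q) → Submodule (FrobVer q) X := fun v =>
    LinearMap.ker (Submodule.mkQ (FrobVer.ideal v • (⊤ : Submodule (FrobVer q) (N (i v)).obj)) ∘ₗ
      π (i v))
  have hκ : ∀ v n, i v ≤ n → ∀ x, x ∈ κ v ↔
      π n x ∈ FrobVer.ideal v • (⊤ : Submodule (FrobVer q) (N n).obj) := by
    intro v n hn x
    induction n, hn using Nat.le_induction with
    | base =>
      rw [LinearMap.mem_ker, LinearMap.comp_apply, Submodule.mkQ_apply,
        Submodule.Quotient.mk_eq_zero]
    | succ n hn ih =>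
      rw [ih, ← (hπ n).2, (N (n + 1)).isLine.mem_smul_top_iff (N n).isLine
        (FrobVer.ker_toProd_anti (hw n.le_succ))
        (FrobVer.ker_toProd_anti ((hi v).trans (hw hn))) (hr n).1]
  let ψ : ∀ v : FinSub V, X →ₗ[FrobVer q] M.obj v := fun v =>
    M.linearMap (hi' v _ le_rfl) ∘ₗ (N (i v.1)).toObj ∘ₗ π (i v.1)
  have hψ : ∀ v n (hn : i v.1 ≤ n) x,
      ψ v x = M.linearMap (hi' v n hn) ((N n).toObj (π n x)) := by
    intro v n hn x
    induction n, hn using Nat.le_induction with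
    | base => rfl
    | succ n hn ih =>
      rw [ih, ← (hπ n).2, (hr n).2, ProModule.linearMap_linearMap]
  have hsurj : ∀ v : FinSub V, Function.Surjective
      (M.linearMap (hi' v _ le_rfl) ∘ₗ (N (i v.1)).toObj) := fun v =>
    (hM.surjective (hi' v _ le_rfl)).comp (N (i v.1)).surjective
  refine ⟨X, inferInstance, inferInstance, κ, ψ, fun v => ?_, fun v w' hvw x hx => ?_, fun v => ?_,
    fun v => ?_, fun v w' h x => ?_⟩
  · exact ((N (i v)).isLine.quotient (FrobVer.ker_toProd_anti (hi v))).of_linearEquiv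
      (LinearMap.quotKerEquivOfSurjective (Submodule.mkQ _ ∘ₗ π (i v))
        ((Submodule.mkQ_surjective _).comp (hπ (i v)).1)).symm
  · rw [hκ w' _ (le_max_left (i w') (i v))] at hx
    rw [hκ v _ (le_max_right (i w') (i v))]
    exact Submodule.smul_mono_left (FrobVer.ker_toProd_anti hvw) hx
  · exact (hsurj v).comp (hπ (i v.1)).1
  -- The stage `i v` surjects onto the line `M_v`, so the kernel is `I_v` times the stage, which is
  -- how `κ v` was defined.
  · ext x
    rw [hκ v.1 _ le_rfl, ← (N (i v.1)).isLine.ker_eq (hM.isLine v)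
      (FrobVer.ker_toProd_anti (hi v.1)) (hsurj v)]
    rfl
  · rw [hψ v _ (le_max_left (i v.1) (i w'.1)), hψ w' _ (le_max_right (i v.1) (i w'.1))]
    exact M.map_map _ _ _

/-- The scalar action of `R_w` on a module killed by the kernel of `ℤ[F, V] / (F V - q) → R_w`. -/
abbrev IsLine.moduleOrder {w : Finset (WeilClass q)} {L : Type} [AddCommGroup L]
    [Module (FrobVer q) L] (hL : IsLine (FrobVer.ideal w) L) : Module (MinCentralOrder w) L :=
  Module.IsTorsionBySet.module (I := FrobVer.ideal w) fun x a => hL.smul_eq_zero a.1 a.2 x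

/-- The projective system of the quotients of a module by a family of submodules. -/
abbrev ProModule.ofQuotients (W : Set (WeilClass q)) {X : Type} [AddCommGroup X]
    [Module (FrobVer q) X] (κ : Finset (WeilClass q) → Submodule (FrobVer q) X)
    (hκ : ∀ w, IsLine (FrobVer.ideal w) (X ⧸ κ w)) (hanti : ∀ v w, v ⊆ w → κ w ≤ κ v) :
    ProModule W where
  obj w := X ⧸ κ w.1
  module w := (hκ w.1).moduleOrder
  map {v w} h :=
    letI := (hκ v.1).moduleOrder
    letI := (hκ w.1).moduleOrder
    { toFun := Submodule.factor (hanti v.1 w.1 h)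
      map_add' := map_add _
      map_smul' := fun a x => by
        obtain ⟨a, rfl⟩ := MinCentralOrder.mk_surjective _ a
        exact map_smul (Submodule.factor (hanti v.1 w.1 h)) a x }
  map_self w x := by
    obtain ⟨x, rfl⟩ := Submodule.Quotient.mk_surjective _ x
    rfl
  map_map huv hvw x := by
    obtain ⟨x, rfl⟩ := Submodule.Quotient.mk_surjective _ x
    rfl

theorem IsLine.invertible_order {w : Finset (WeilClass q)} {L : Type} [AddCommGroup L]
    [Module (FrobVer q) L] (hL : IsLine (FrobVer.ideal w) L) :
    letI := hL.moduleOrder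
    Module.Invertible (MinCentralOrder w) L := by
  let _ : Module (FrobVer q ⧸ FrobVer.ideal w) L := hL.moduleOrder
  have : IsScalarTower (FrobVer q) (FrobVer q ⧸ FrobVer.ideal w) L :=
    ⟨fun a b x => by
      obtain ⟨b, rfl⟩ := Ideal.Quotient.mk_surjective b
      exact mul_smul a b x⟩
  exact hL.invertible

theorem ProModule.ofQuotients_isInvertible (W : Set (WeilClass q)) {X : Type} [AddCommGroup X]
    [Module (FrobVer q) X] (κ : Finset (WeilClass q) → Submodule (FrobVer q) X)
    (hκ : ∀ w, IsLine (FrobVer.ideal w) (X ⧸ κ w)) (hanti : ∀ v w, v ⊆ w → κ w ≤ κ v) :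
    (ProModule.ofQuotients W κ hκ hanti).IsInvertible where
  invertible w := (hκ w.1).invertible_order
  surjective {v w} h := Submodule.factor_surjective (hanti v.1 w.1 h)

/-- A linear equivalence over `ℤ[F, V] / (F V - q)` between `R_w`-modules is `R_w`-linear. -/
def LinearEquiv.overOrder {w : Finset (WeilClass q)} {L L' : Type} [AddCommGroup L]
    [AddCommGroup L'] [Module (FrobVer q) L] [Module (FrobVer q) L'] [Module (MinCentralOrder w) L]
    [Module (MinCentralOrder w) L'] (e : L ≃ₗ[FrobVer q] L')
    (h : ∀ (a : FrobVer q) (x : L), MinCentralOrder.mk w a • x = a • x)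
    (h' : ∀ (a : FrobVer q) (x : L'), MinCentralOrder.mk w a • x = a • x) :
    L ≃ₗ[MinCentralOrder w] L' where
  __ := e.toAddEquiv
  map_smul' a x := by
    obtain ⟨a, rfl⟩ := MinCentralOrder.mk_surjective w a
    change e (MinCentralOrder.mk w a • x) = MinCentralOrder.mk w a • e x
    rw [h, h', map_smul]

/-- Every invertible `R_V`-module extends to an invertible `R_W`-module. -/
theorem ProModule.IsInvertible.exists_restrict_iso {M : ProModule V} (hM : M.IsInvertible)
    (h : V ⊆ W) :
    ∃ N : ProModule W, N.IsInvertible ∧ Nonempty (ProModule.Iso (N.restrict h) M) := by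
  obtain ⟨X, _, _, κ, ψ, hκ, hanti, hψ, hker, hmap⟩ := hM.exists_limit
  refine ⟨.ofQuotients W κ hκ hanti, ProModule.ofQuotients_isInvertible W κ hκ hanti, ⟨?_⟩⟩
  let e : ∀ v : FinSub V, (X ⧸ κ v.1) ≃ₗ[FrobVer q] M.obj v := fun v =>
    (Submodule.quotEquivOfEq _ _ (hker v).symm).trans ((ψ v).quotKerEquivOfSurjective (hψ v))
  refine ⟨fun v =>
    letI := (hκ v.1).moduleOrder
    LinearEquiv.overOrder (e v) (fun _ _ => rfl) (fun _ _ => rfl), ?_⟩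
  intro v w hvw x
  obtain ⟨x, rfl⟩ := Submodule.Quotient.mk_surjective _ x
  exact (hmap v w hvw x).symm

end Weil

end

/-- For `q` a prime power and subsets `V ⊆ W ⊆ W_q`, the natural restriction homomorphism
`Pic(R_W) → Pic(R_V)` is surjective. -/
theorem mainTheorem10 (q : ℕ) (hq : IsPrimePow q) (V W : Set (WeilClass q)) (hVW : V ⊆ W) :
    Function.Surjective (ProPic.restrict hVW : ProPic W →* ProPic V) := by
  intro a
  obtain ⟨M, hM, rfl⟩ := ProPic.exists_mk a
  obtain ⟨N, hN, hiso⟩ := hM.exists_restrict_iso hVW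
  exact ⟨ProPic.mk N hN, ProPic.mk_eq_mk_iff.2 hiso⟩
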